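/- Let $k\ge 3$ and let $A_k=\langle a,b \mid aba\cdots = bab\cdots\rangle$ (with $k$ factors on each side of the relation) be the Artin group of dihedral type. Write $\mathrm{prod}(s,t;n)=stst\cdots$ for the alternating product with $n$ factors. The dual generators of $A_k$ are $\sigma_1=a$, $\sigma_2=b$ and, for $3\le j\le k$, $$\sigma_j=\begin{cases}\mathrm{prod}(b^{-1},a^{-1};j-2)\,\mathrm{prod}(a,b;j-1), & j\text{ odd},\\ \mathrm{prod}(b^{-1},a^{-1};j-2)\,\mathrm{prod}(b,a;j-1), & j\text{ even}.\end{cases}$$ For a finite generating set $S$ of a group $G$ with identity $e$, let $d_S$ be the left-invariant word metric (words in the letters $S\cup S^{-1}$), and for $z\in G$ let $\psi_z:G\to\mathbb{R}$, $\psi_z(x)=d_S(x,z)-d_S(e,z)$. The horofunction boundary of $(G,d_S)$ is $\overline{\{\psi_z : z\in G\}}\setminus\{\psi_z : z\in G\}$, the closure being taken in the topology of pointwise convergence (which on the discrete space $G$ is uniform convergence on compact sets). Its elements are called horofunctions. A horofunction is a Busemann point if it is the limit of $\psi_{\gamma(n)}$ as $n\to\infty$ for some geodesic ray $\gamma:\mathbb{N}\to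 G$, that is, a map with $d_S(\gamma(m),\gamma(n))=|m-n|$ for all $m,n$. **Theorem.** Let $k\ge 3$. 1. In the horofunction boundary of $A_k$ with the word metric of the dual generators $\sigma_1,\dots,\sigma_k$, every horofunction is a Busemann point. 2. In the horofunction boundary of $A_k$ with the word metric of the Artin generators $a,b$, there is a horofunction that is not a Busemann point. Hence, for each $k\ge3$, whether non-Busemann points exist in the horofunction boundary of $A_k$ depends on the generating set. -/

import Mathlib

open Filter Topology
open scoped Pointwise

/-! ### Word metrics, horofunctions and Busemann points -/

/-- The word length of `g` with respect to `S`: the least length of a word with letters in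
`S ∪ S⁻¹` that represents `g`. (It is used here only for sets `S` that generate the group.) -/
noncomputable def wordLength {G : Type*} [Group G] (S : Set G) (g : G) : ℕ :=
  sInf {n : ℕ | ∃ l : List G, l.length = n ∧ (∀ x ∈ l, x ∈ S ∪ S⁻¹) ∧ l.prod = g}

/-- The left-invariant word metric of `S`. -/
noncomputable def wordDist {G : Type*} [Group G] (S : Set G) (x y : G) : ℕ :=
  wordLength S (x⁻¹ * y)

/-- The function `x ↦ d(x, z) - d(e, z)`, where `d` is the word metric of `S`. The base point is
the identity. -/
noncomputable def horoEmbed {G : Type*} [Group G] (S : Set G) (z : G) : G → ℝ :=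
  fun x => (wordDist S x z : ℝ) - (wordDist S 1 z : ℝ)

/-- The horofunction boundary of `G` with the word metric of `S`; its elements are the
horofunctions. The group is discrete, so all real functions on it are continuous, and uniform
convergence on compact sets is pointwise convergence, i.e. convergence in the product topology of
`G → ℝ`. -/
def horoBoundary {G : Type*} [Group G] (S : Set G) : Set (G → ℝ) :=
  closure (Set.range (horoEmbed S)) \ Set.range (horoEmbed S)

/-- `γ` is a geodesic ray for the word metric of `S`. -/
def IsGeodesicRay {G : Type*} [Group G] (S : Set G) (γ : ℕ → G) : Prop :=
  ∀ m n : ℕ, wordDist S (γ m) (γ (m + n)) = n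

/-- A Busemann point is a horofunction that is the limit of a geodesic ray. -/
def IsBusemannPoint {G : Type*} [Group G] (S : Set G) (ξ : G → ℝ) : Prop :=
  ξ ∈ horoBoundary S ∧
    ∃ γ : ℕ → G, IsGeodesicRay S γ ∧ Tendsto (fun n => horoEmbed S (γ n)) atTop (𝓝 ξ)

/-! ### Artin groups of dihedral type -/

/-- The alternating product `s t s t ⋯` with `n` factors. -/
def altProd {G : Type*} [Group G] (s t : G) : ℕ → G
  | 0 => 1
  | n + 1 => s * altProd t s n

/-- The relation `a b a ⋯ = b a b ⋯`, with `k` factors on each side, as a relator in the free group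
on the two generators `a = FreeGroup.of 0` and `b = FreeGroup.of 1`. -/
def dihedralArtinRel (k : ℕ) : Set (FreeGroup (Fin 2)) :=
  {altProd (FreeGroup.of 0) (FreeGroup.of 1) k * (altProd (FreeGroup.of 1) (FreeGroup.of 0) k)⁻¹}

/-- The Artin group of dihedral type `A_k = ⟨a, b | a b a ⋯ = b a b ⋯⟩`, with `k` factors on each
side of the relation. -/
abbrev DihedralArtin (k : ℕ) : Type := PresentedGroup (dihedralArtinRel k)

namespace DihedralArtin

/-- The Artin generator `a`. -/
def a (k : ℕ) : DihedralArtin k := PresentedGroup.of 0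

/-- The Artin generator `b`. -/
def b (k : ℕ) : DihedralArtin k := PresentedGroup.of 1

/-- The Artin generators `a`, `b` (word metrics use their inverses as well). -/
def artinGenerators (k : ℕ) : Set (DihedralArtin k) := {a k, b k}

/-- The elements `σ_1, σ_2, …` (the dual generators of `A_k` are `σ_1, …, σ_k`; the value at the
index `0` is not used). -/
def sigma (k : ℕ) (j : ℕ) : DihedralArtin k :=
  if j = 1 then a k
  else if j = 2 then b k
  else if Odd j then altProd (b k)⁻¹ (a k)⁻¹ (j - 2) * altProd (a k) (b k) (j - 1)
  else altProd (b k)⁻¹ (a k)⁻¹ (j - 2) * altProd (b k) (a k) (j - 1)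

/-- The dual generators `σ_1, …, σ_k` (word metrics use their inverses as well). -/
def dualGenerators (k : ℕ) : Set (DihedralArtin k) := sigma k '' Set.Icc 1 k

/-- The Artin generators generate the group, so that their word metric is meaningful. -/
theorem closure_artinGenerators (k : ℕ) : Subgroup.closure (artinGenerators k) = ⊤ := by
  rw [← PresentedGroup.closure_range_of (dihedralArtinRel k)]
  congr 1
  ext x
  simp [artinGenerators, a, b, eq_comm]

/-- The dual generators generate the group, so that their word metric is meaningful. -/
theorem closure_dualGenerators (k : ℕ) (hk : 2 ≤ k) :
    Subgroup.closure (dualGenerators k) = ⊤ := by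
  rw [eq_top_iff, ← closure_artinGenerators k]
  apply Subgroup.closure_mono
  rintro x (rfl | rfl)
  · exact ⟨1, ⟨le_rfl, by omega⟩, by simp [sigma]⟩
  · exact ⟨2, ⟨by omega, hk⟩, by simp [sigma]⟩

end DihedralArtin

/-! ### Word metrics -/

section WordMetric

variable {G : Type*} [Group G] {S : Set G}

/-! Dual generators. Indexed by `ZMod k`, they satisfy `dualGen i * dualGen (i + 1) = δ` with the
same element δ = ab for every `i`. The group acts on the `k`-regular tree of reduced lists, each
generator acting as an index shift followed by a toggle of the head. An element `x` is determined by
the vertex `path x` to which it moves the root together with its exponent sum, and all pairs of the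
right parity occur. By `wordLength_dualGenerators` the word metric is the supremum metric of the
tree and the line. Along an ultrafilter that converges to a horofunction, the difference |path| -
|deg| tends to ∞, tends to -∞, or is eventually constant. Accordingly the horofunction is, up to
normalisation, a Busemann function of the tree, one of the line, or a maximum of shifts of two such
functions, and in each case an explicit geodesic ray converges to it.

Artin generators. Let ξ be a limit of the functions ψ of the inverses of w_n = b⁻ⁿaⁿ, and let Δ be
the Garside element. Conjugation by Δ permutes the letters and b⁻¹Δ has length at most k - 1, so
ξ(Δ^s) ≤ s(k - 2). A potential on a tree of polygons (`le_wordLength_artinGenerators`) gives deg y -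
|y| ≤ 2ξ(y). If a geodesic ray γ converged to ξ, then ξ would decrease along γ with slope one, and
this lower bound would bound |γ m| + deg (γ m), twice the number of positive letters in a shortest
word, by a constant C. The degree then shows |Δ^{-s} γ m| - |γ m| ≥ sk - C, hence ξ(Δ^s) ≥ sk - C,
which is impossible for large s. -/

theorem wordLength_prod_le {l : List G} (hl : ∀ x ∈ l, x ∈ S ∪ S⁻¹) :
    wordLength S l.prod ≤ l.length :=
  Nat.sInf_le ⟨l, rfl, hl, rfl⟩

theorem exists_word_length_eq (hS : Subgroup.closure S = ⊤) (g : G) :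
    ∃ l : List G, l.length = wordLength S g ∧ (∀ x ∈ l, x ∈ S ∪ S⁻¹) ∧ l.prod = g := by
  have hg : g ∈ Submonoid.closure (S ∪ S⁻¹) := by
    rw [← Subgroup.closure_toSubmonoid, hS]; trivial
  obtain ⟨l, hl, hp⟩ := Submonoid.exists_list_of_mem_closure hg
  exact Nat.sInf_mem (s := {n : ℕ | ∃ l : List G, l.length = n ∧ (∀ x ∈ l, x ∈ S ∪ S⁻¹) ∧
    l.prod = g}) ⟨l.length, l, rfl, hl, hp⟩

@[simp]
theorem wordLength_one : wordLength S (1 : G) = 0 := by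
  simpa using wordLength_prod_le (S := S) (l := []) (by simp)

theorem wordLength_le_one {x : G} (hx : x ∈ S ∪ S⁻¹) : wordLength S x ≤ 1 := by
  simpa using wordLength_prod_le (S := S) (l := [x]) (by simpa using hx)

theorem wordLength_mul_le (hS : Subgroup.closure S = ⊤) (x y : G) :
    wordLength S (x * y) ≤ wordLength S x + wordLength S y := by
  obtain ⟨l, hl, hl', rfl⟩ := exists_word_length_eq hS x
  obtain ⟨m, hm, hm', rfl⟩ := exists_word_length_eq hS y
  rw [← hl, ← hm, ← List.prod_append, ← List.length_append]
  apply wordLength_prod_le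
  intro z hz
  rcases List.mem_append.1 hz with h | h
  exacts [hl' z h, hm' z h]

theorem wordLength_inv_le (hS : Subgroup.closure S = ⊤) (x : G) :
    wordLength S x⁻¹ ≤ wordLength S x := by
  obtain ⟨l, hl, hl', rfl⟩ := exists_word_length_eq hS x
  rw [List.prod_inv_reverse, ← hl]
  refine (wordLength_prod_le ?_).trans (by simp)
  intro z hz
  simp only [List.mem_reverse, List.mem_map] at hz
  obtain ⟨y, hy, rfl⟩ := hz
  simpa [or_comm] using hl' y hy

theorem wordLength_inv (hS : Subgroup.closure S = ⊤) (x : G) :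
    wordLength S x⁻¹ = wordLength S x :=
  (wordLength_inv_le hS x).antisymm (by simpa using wordLength_inv_le hS x⁻¹)

theorem wordLength_pow_le (hS : Subgroup.closure S = ⊤) (x : G) (n : ℕ) :
    wordLength S (x ^ n) ≤ n * wordLength S x := by
  induction n with
  | zero => simp
  | succ n ih =>
    rw [pow_succ, add_mul, one_mul]
    exact (wordLength_mul_le hS _ _).trans (by gcongr)

/-- A homomorphism to `ℤ` that is `±1` on the letters is bounded by the word length. -/
theorem natAbs_le_wordLength (hS : Subgroup.closure S = ⊤) (f : G →* Multiplicative ℤ)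
    (hf : ∀ x ∈ S, (f x).toAdd = 1) (g : G) : (f g).toAdd.natAbs ≤ wordLength S g := by
  obtain ⟨l, hl, hl', rfl⟩ := exists_word_length_eq hS g
  rw [← hl]
  clear hl
  induction l with
  | nil => simp
  | cons x l ih =>
    have h1 := ih fun y hy => hl' y (by simp [hy])
    have h2 : (f x).toAdd.natAbs = 1 := by
      rcases hl' x (by simp) with h | h
      · simp [hf x h]
      · have := hf _ h
        rw [map_inv, toAdd_inv] at this
        omega
    simp only [List.prod_cons, map_mul, toAdd_mul, List.length_cons]
    omega

theorem horoEmbed_apply (z x : G) :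
    horoEmbed S z x = (wordLength S (x⁻¹ * z) : ℝ) - wordLength S z := by
  simp [horoEmbed, wordDist]

theorem abs_horoEmbed_le (hS : Subgroup.closure S = ⊤) (z x : G) :
    |horoEmbed S z x| ≤ wordLength S x := by
  rw [horoEmbed_apply, abs_le]
  have h1 := wordLength_mul_le hS x⁻¹ z
  have h2 := wordLength_mul_le hS x (x⁻¹ * z)
  rw [wordLength_inv hS] at h1
  rw [mul_inv_cancel_left] at h2
  have h1' : (wordLength S (x⁻¹ * z) : ℝ) ≤ wordLength S x + wordLength S z := by exact_mod_cast h1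
  have h2' : (wordLength S z : ℝ) ≤ wordLength S x + wordLength S (x⁻¹ * z) := by exact_mod_cast h2
  constructor <;> linarith

/-- Along every ultrafilter, the functions `horoEmbed S z` converge. -/
theorem exists_tendsto_horoEmbed (hS : Subgroup.closure S = ⊤) {ι : Type*} (u : Ultrafilter ι)
    (z : ι → G) : ∃ ξ : G → ℝ, Tendsto (fun i => horoEmbed S (z i)) u (𝓝 ξ) := by
  have hK : IsCompact (Set.univ.pi fun x : G =>
      Set.Icc (-(wordLength S x : ℝ)) (wordLength S x)) :=
    isCompact_univ_pi fun _ => isCompact_Icc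
  obtain ⟨ξ, -, hξ⟩ := hK.ultrafilter_le_nhds (u.map fun i => horoEmbed S (z i)) (by
    rw [le_principal_iff]
    exact mem_map.2 (univ_mem' fun i x _ => abs_le.1 (abs_horoEmbed_le hS (z i) x)))
  exact ⟨ξ, hξ⟩

/-- Every point of the closure is a limit along an ultrafilter on the group. -/
theorem exists_ultrafilter_tendsto {ξ : G → ℝ} (hξ : ξ ∈ closure (Set.range (horoEmbed S))) :
    ∃ u : Ultrafilter G, Tendsto (horoEmbed S) u (𝓝 ξ) := by
  have : (comap (horoEmbed S) (𝓝 ξ)).NeBot := by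
    rw [comap_neBot_iff]
    intro t ht
    obtain ⟨_, h1, z, rfl⟩ := mem_closure_iff_nhds.1 hξ t ht
    exact ⟨z, h1⟩
  exact ⟨Ultrafilter.of _, tendsto_iff_comap.2 (Ultrafilter.of_le _)⟩

/-- Along a geodesic ray, its limit decreases with slope one. -/
theorem IsGeodesicRay.limit_apply {γ : ℕ → G} (hγ : IsGeodesicRay S γ) {ξ : G → ℝ}
    (h : Tendsto (fun n => horoEmbed S (γ n)) atTop (𝓝 ξ)) (m : ℕ) :
    ξ (γ m) = ξ (γ 0) - m := by
  rw [tendsto_pi_nhds] at h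
  have h0 := (h (γ 0)).sub_const (m : ℝ)
  refine tendsto_nhds_unique (h (γ m)) (h0.congr' ?_)
  filter_upwards [eventually_ge_atTop m] with n hn
  obtain ⟨j, rfl⟩ := Nat.exists_eq_add_of_le hn
  have h1 := hγ m j
  have h2 := hγ 0 (m + j)
  rw [Nat.zero_add] at h2
  simp only [horoEmbed, h1, h2]
  push_cast
  ring

end WordMetric

/-! ### Alternating products as powers. -/

section AltProd

variable {H : Type*} [Group H]

theorem altProd_two_mul (s t : H) (m : ℕ) : altProd s t (2 * m) = (s * t) ^ m := by
  induction m with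
  | zero => simp [altProd]
  | succ m ih => rw [Nat.mul_succ, pow_succ', ← ih, mul_assoc]; rfl

theorem altProd_two_mul_add_one (s t : H) (m : ℕ) :
    altProd s t (2 * m + 1) = s * (t * s) ^ m := by
  rw [← altProd_two_mul]; rfl

theorem map_altProd {K : Type*} [Group K] (f : H →* K) (s t : H) (n : ℕ) :
    f (altProd s t n) = altProd (f s) (f t) n := by
  induction n generalizing s t with
  | zero => exact map_one f
  | succ n ih => simp only [altProd, map_mul, ih]

end AltProd

namespace DihedralArtin

/-! ### Homomorphisms from the presentation, and the exponent sum. -/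

variable (k : ℕ)

/-- The homomorphism from the Artin group given by two elements satisfying the relation. -/
def lift {H : Type*} [Group H] (s t : H) (h : altProd s t k = altProd t s k) :
    DihedralArtin k →* H :=
  PresentedGroup.toGroup (f := ![s, t]) (by
    rintro r rfl
    simp [map_altProd, h])

variable {k}

section
variable {H : Type*} [Group H] {s t : H} (h : altProd s t k = altProd t s k)

@[simp] theorem lift_a : lift k s t h (a k) = s := by
  simp [lift, a]

@[simp] theorem lift_b : lift k s t h (b k) = t := by
  simp [lift, b]

end

theorem altProd_a_b : altProd (a k) (b k) k = altProd (b k) (a k) k := by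
  have h : PresentedGroup.mk (dihedralArtinRel k) (altProd (FreeGroup.of 0) (FreeGroup.of 1) k *
      (altProd (FreeGroup.of 1) (FreeGroup.of 0) k)⁻¹) = 1 :=
    PresentedGroup.one_of_mem (by exact Set.mem_singleton _)
  rw [map_mul, map_inv, mul_inv_eq_one, map_altProd, map_altProd] at h
  exact h

variable (k) in
/-- The degree: the exponent sum. -/
def deg : DihedralArtin k →* Multiplicative ℤ :=
  lift k (.ofAdd 1) (.ofAdd 1) rfl

@[simp] theorem deg_a : deg k (a k) = .ofAdd 1 := lift_a _

@[simp] theorem deg_b : deg k (b k) = .ofAdd 1 := lift_b _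

end DihedralArtin

/-! ### The regular tree of reduced lists -/

namespace DihedralArtin

section Tree

variable {k : ℕ}

/-- Remove the head of a list if it is `i`, and prepend `i` otherwise. -/
def toggle (i : ZMod k) : List (ZMod k) → List (ZMod k)
  | [] => [i]
  | j :: l => if j = i then l else i :: j :: l

/-- The distance of two reduced lists, as vertices of the tree in which a list is adjacent to its
extensions by one last entry. -/
def treeDist : List (ZMod k) → List (ZMod k) → ℕ
  | [], m => m.length
  | l, [] => l.length
  | i :: l, j :: m => if i = j then treeDist l m else l.length + m.length + 2

variable (k) in
/-- The lists without equal neighbours, which are the vertices of the `k`-regular tree. -/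
abbrev TreeVertex : Type := {l : List (ZMod k) // l.IsChain (· ≠ ·)}

theorem isChain_toggle (i : ZMod k) {l : List (ZMod k)} (hl : l.IsChain (· ≠ ·)) :
    (toggle i l).IsChain (· ≠ ·) := by
  cases l with
  | nil => simp [toggle]
  | cons j l =>
    rw [toggle]
    split_ifs with h
    · exact hl.tail
    · exact List.isChain_cons_cons.2 ⟨Ne.symm h, hl⟩

theorem isChain_map_add (c : ZMod k) {l : List (ZMod k)} (hl : l.IsChain (· ≠ ·)) :
    (l.map (· + c)).IsChain (· ≠ ·) := by
  rw [List.isChain_map]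
  exact hl.imp fun a b h => by simpa using h

theorem toggle_toggle (i : ZMod k) {l : List (ZMod k)} (hl : l.IsChain (· ≠ ·)) :
    toggle i (toggle i l) = l := by
  cases l with
  | nil => simp [toggle]
  | cons j l =>
    by_cases h : j = i
    · subst h
      cases l with
      | nil => simp [toggle]
      | cons m l => simp [toggle, (List.isChain_cons_cons.1 hl).1.symm]
    · simp [toggle, h]

theorem map_add_toggle (c i : ZMod k) (l : List (ZMod k)) :
    (toggle i l).map (· + c) = toggle (i + c) (l.map (· + c)) := by
  cases l with
  | nil => simp [toggle]
  | cons j l =>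
    by_cases h : j = i
    · simp [toggle, h]
    · simp [toggle, h]

theorem length_toggle (i : ZMod k) (l : List (ZMod k)) :
    toggle i l = i :: l ∨ l = i :: toggle i l := by
  cases l with
  | nil => simp [toggle]
  | cons j l =>
    by_cases h : j = i
    · simp [toggle, h]
    · simp [toggle, h]

@[simp] theorem treeDist_nil_left (l : List (ZMod k)) : treeDist [] l = l.length := by
  simp [treeDist]

@[simp] theorem treeDist_nil_right (l : List (ZMod k)) : treeDist l [] = l.length := by
  cases l <;> simp [treeDist]

@[simp] theorem treeDist_self (l : List (ZMod k)) : treeDist l l = 0 := by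
  induction l with
  | nil => simp
  | cons i l ih => simp [treeDist, ih]

theorem eq_of_treeDist_eq_zero {l m : List (ZMod k)} (h : treeDist l m = 0) : l = m := by
  induction l generalizing m with
  | nil => simpa [eq_comm] using h
  | cons i l ih =>
    cases m with
    | nil => simp at h
    | cons j m =>
      by_cases hij : i = j
      · rw [hij, ih (by simpa [treeDist, hij] using h)]
      · simp [treeDist, hij] at h

theorem treeDist_map_add (c : ZMod k) (l m : List (ZMod k)) :
    treeDist (l.map (· + c)) (m.map (· + c)) = treeDist l m := by
  induction l generalizing m with
  | nil => simp
  | cons i l ih =>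
    cases m with
    | nil => simp
    | cons j m => simp [treeDist, ih]

/-- On reduced lists, `toggle i` is left multiplication by the `i`-th generator in the free product
of `k` copies of ℤ/2, so it is an automorphism of the Cayley tree. -/
theorem treeDist_toggle (i : ZMod k) {l m : List (ZMod k)} (hl : l.IsChain (· ≠ ·))
    (hm : m.IsChain (· ≠ ·)) : treeDist (toggle i l) (toggle i m) = treeDist l m := by
  -- The only case with content: `i` is deleted from the front of one list and prepended to the
  -- other.
  have key : ∀ {l m : List (ZMod k)}, (i :: l).IsChain (· ≠ ·) → m.head? ≠ some i →
      treeDist l (i :: m) = treeDist (i :: l) m := by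
    intro l m hl hm
    cases l with
    | nil => cases m with
      | nil => simp
      | cons j m => simp_all [treeDist, eq_comm]
    | cons p l =>
      have h1 := (List.isChain_cons_cons.1 hl).1.symm
      cases m with
      | nil => simp [treeDist, h1]
      | cons j m =>
        have h2 : i ≠ j := fun h => by simp [h] at hm
        simp [treeDist, h1, h2]
        omega
  have comm : ∀ l m : List (ZMod k), treeDist l m = treeDist m l := by
    intro l
    induction l with
    | nil => simp
    | cons p l ih =>
      intro m
      cases m with
      | nil => simp
      | cons q m =>
        by_cases h : p = q
        · simp [treeDist, h, ih m]
        · simp [treeDist, h, Ne.symm h]; omega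
  have ht : ∀ {m : List (ZMod k)}, m.head? ≠ some i → toggle i m = i :: m := by
    intro m hm
    cases m with
    | nil => rfl
    | cons j m => simp_all [toggle]
  have ht' : ∀ {m : List (ZMod k)}, m.head? = some i → ∃ m', m = i :: m' ∧ toggle i m = m' := by
    intro m hm
    cases m with
    | nil => simp at hm
    | cons j m => simp_all [toggle]
  by_cases h1 : l.head? = some i <;> by_cases h2 : m.head? = some i
  · obtain ⟨l, rfl, e1⟩ := ht' h1
    obtain ⟨m, rfl, e2⟩ := ht' h2
    rw [e1, e2]
    simp [treeDist]
  · obtain ⟨l, rfl, e1⟩ := ht' h1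
    rw [e1, ht h2, key hl h2]
  · obtain ⟨m, rfl, e2⟩ := ht' h2
    rw [e2, ht h1, comm, key hm h1, comm]
  · rw [ht h1, ht h2]
    simp [treeDist]

/-- The common prefix with `l` cannot reach into `n`. This makes the distance to a far vertex depend
only on a bounded prefix of it, up to an additive length. -/
theorem treeDist_append {l m : List (ZMod k)} (h : l.length ≤ m.length) (n : List (ZMod k)) :
    treeDist l (m ++ n) = treeDist l m + n.length := by
  induction l generalizing m with
  | nil => simp
  | cons i l ih =>
    cases m with
    | nil => simp at h
    | cons j m =>
      by_cases hij : i = j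
      · simp [treeDist, hij, ih (by simpa using h)]
      · simp [treeDist, hij]
        omega

theorem treeDist_le (l m : List (ZMod k)) : treeDist l m ≤ l.length + m.length := by
  induction l generalizing m with
  | nil => simp
  | cons i l ih =>
    cases m with
    | nil => simp
    | cons j m =>
      have := ih m
      simp only [treeDist, List.length_cons]
      split_ifs <;> omega

/-- The action of a dual generator on the tree. -/
def dualPerm (i : ZMod k) : Equiv.Perm (TreeVertex k) where
  toFun l := ⟨toggle i (l.1.map (· + -1)), isChain_toggle i (isChain_map_add _ l.2)⟩
  invFun l := ⟨(toggle i l.1).map (· + 1), isChain_map_add _ (isChain_toggle i l.2)⟩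
  left_inv l := by
    ext1
    simp [toggle_toggle i (isChain_map_add (-1) l.2)]
  right_inv l := by
    ext1
    simp [toggle_toggle i l.2]

/-- The shift turns `toggle (i + 1)` into `toggle i`, so the two toggles cancel. What remains does
not depend on `i`, which is the dual form of the Artin relation. -/
theorem dualPerm_mul (i : ZMod k) (l : TreeVertex k) :
    ((dualPerm i * dualPerm (i + 1) : Equiv.Perm (TreeVertex k)) l).1 = l.1.map (· + -2) := by
  have h : (l.1.map (· + -2)) = (l.1.map (· + -1)).map (· + (-1 : ZMod k)) := by
    simp only [List.map_map]
    congr 1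
    funext x
    simp only [Function.comp]
    ring
  rw [h]
  simp only [dualPerm, Equiv.Perm.coe_mul, Function.comp, Equiv.coe_fn_mk]
  rw [map_add_toggle, add_neg_cancel_right,
    toggle_toggle i (isChain_map_add _ (isChain_map_add _ l.2))]

end Tree

/-! ### Dual generators -/

section DualRelations

variable {k : ℕ} {H : Type*} [Group H] {s : ZMod k → H} {d : H}

theorem mul_pow_of_mul_succ (h : ∀ i, s i * s (i + 1) = d) (i : ZMod k) (m : ℕ) :
    s i * d ^ m = d ^ m * s (i + 2 * m) := by
  induction m with
  | zero => simp
  | succ m ih =>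
    have h1 : ∀ j, s j * d = d * s (j + 2) := fun j => by
      rw [← h (j + 1), ← mul_assoc, h j, h (j + 1), add_assoc, one_add_one_eq_two]
    rw [pow_succ, ← mul_assoc, ih, mul_assoc, h1, mul_assoc]
    push_cast
    ring_nf

/-- Moving a generator past `d ^ m` shifts its index by `2 * m`. For `k = 2 * m` the shift is
trivial, so `s 1`, which conjugates `d` to `s 1 * s 0`, commutes with `d ^ m`. For `k = 2 * m + 1`
the shift takes the index `1` to `0`. -/
theorem altProd_of_mul_succ (h : ∀ i, s i * s (i + 1) = d) :
    altProd (s 0) (s 1) k = altProd (s 1) (s 0) k := by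
  have h0 : s 0 * s 1 = d := by simpa using h 0
  rcases Nat.even_or_odd' k with ⟨m, hm | hm⟩
  · have e : ∀ x y : H, altProd x y k = (x * y) ^ m := fun x y => by rw [hm, altProd_two_mul]
    have h2 := mul_pow_of_mul_succ h 1 m
    have h3 : (1 : ZMod k) + 2 * m = 1 := by
      have : ((2 * m : ℕ) : ZMod k) = 0 := by rw [← hm]; simp
      push_cast at this
      rw [this, add_zero]
    have h4 : s 1 * s 0 = s 1 * d * (s 1)⁻¹ := by rw [← h0]; group
    rw [e, e, h0, h4, conj_pow, h2, h3, mul_inv_cancel_right]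
  · have e : ∀ x y : H, altProd x y k = x * (y * x) ^ m := fun x y => by
      rw [hm, altProd_two_mul_add_one]
    have h3 : (1 : ZMod k) + 2 * m = 0 := by
      have : ((2 * m + 1 : ℕ) : ZMod k) = 0 := by rw [← hm]; simp
      push_cast at this
      rw [add_comm, this]
    have h4 : s 1 * s 0 = (s 0)⁻¹ * d * (s 0)⁻¹⁻¹ := by rw [← h0]; group
    rw [e, e, h0, h4, conj_pow, mul_pow_of_mul_succ h, h3]
    group

end DualRelations

variable {k : ℕ}

/-- As conjugates of `a` and `b` by powers of `ab`, the dual generators telescope in consecutive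
products. -/
theorem sigma_odd (m : ℕ) :
    sigma k (2 * m + 1) = ((a k * b k) ^ m)⁻¹ * a k * (a k * b k) ^ m := by
  cases m with
  | zero => simp [sigma]
  | succ m =>
    have h1 : 2 * (m + 1) + 1 - 2 = 2 * m + 1 := by omega
    have h2 : 2 * (m + 1) + 1 - 1 = 2 * (m + 1) := by omega
    have h3 : (b k)⁻¹ = (a k * b k)⁻¹ * a k := by group
    rw [sigma, if_neg (by omega), if_neg (by omega), if_pos ⟨m + 1, rfl⟩, h1, h2,
      altProd_two_mul, altProd_two_mul_add_one, ← mul_pow_mul, ← mul_inv_rev, inv_pow, h3,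
      ← mul_assoc, ← mul_inv_rev, ← pow_succ']

theorem sigma_even (m : ℕ) :
    sigma k (2 * m + 2) = ((a k * b k) ^ m)⁻¹ * b k * (a k * b k) ^ m := by
  cases m with
  | zero => simp [sigma]
  | succ m =>
    have h1 : 2 * (m + 1) + 2 - 2 = 2 * (m + 1) := by omega
    have h2 : 2 * (m + 1) + 2 - 1 = 2 * (m + 1) + 1 := by omega
    rw [sigma, if_neg (by omega), if_neg (by omega), if_neg (by simp [parity_simps]), h1, h2,
      altProd_two_mul, altProd_two_mul_add_one, ← mul_inv_rev, inv_pow, mul_assoc]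

theorem sigma_mul_succ (n : ℕ) : sigma k (n + 1) * sigma k (n + 2) = a k * b k := by
  rcases Nat.even_or_odd' n with ⟨m, rfl | rfl⟩
  · have h : ((a k * b k) ^ m)⁻¹ * (a k * b k) * (a k * b k) ^ m = a k * b k := by
      rw [mul_assoc, ← pow_succ', pow_succ, inv_mul_cancel_left]
    rw [sigma_odd, sigma_even]
    simpa [mul_assoc] using h
  · have e : 2 * m + 1 + 2 = 2 * (m + 1) + 1 := by ring
    have h : ((a k * b k) ^ (m + 1))⁻¹ = ((a k * b k) ^ m)⁻¹ * (a k * b k)⁻¹ := by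
      rw [pow_succ', mul_inv_rev]
    rw [e, sigma_even, sigma_odd, h, pow_succ]
    generalize (a k * b k) ^ m = D
    group

/-- The Artin relation makes the sequence close up after `k` terms, so that cyclic indexing is
legitimate. -/
theorem sigma_succ_self : sigma k (k + 1) = a k := by
  have h := altProd_a_b (k := k)
  rcases Nat.even_or_odd' k with ⟨m, hm | hm⟩
  · have e : ∀ x y : DihedralArtin k, altProd x y k = (x * y) ^ m := fun x y =>
      (congrArg (altProd x y) hm).trans (altProd_two_mul x y m)
    have h1 : sigma k (k + 1) = sigma k (2 * m + 1) := congrArg (fun n => sigma k (n + 1)) hm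
    rw [e, e] at h
    rw [h1, sigma_odd, mul_assoc, inv_mul_eq_iff_eq_mul, mul_pow_mul, h]
  · have e : ∀ x y : DihedralArtin k, altProd x y k = x * (y * x) ^ m := fun x y =>
      (congrArg (altProd x y) hm).trans (altProd_two_mul_add_one x y m)
    have h1 : sigma k (k + 1) = sigma k (2 * m + 2) := congrArg (fun n => sigma k (n + 1)) hm
    rw [e, e] at h
    rw [h1, sigma_even, mul_assoc, inv_mul_eq_iff_eq_mul, mul_pow_mul, h]

/-- The dual generators, indexed cyclically from `0`. -/
noncomputable def dualGen (i : ZMod k) : DihedralArtin k := sigma k (i.val + 1)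

section

variable [NeZero k]

theorem dualGen_natCast {n : ℕ} (h : n ≤ k) : dualGen (n : ZMod k) = sigma k (n + 1) := by
  rcases h.lt_or_eq with h | rfl
  · rw [dualGen, ZMod.val_cast_of_lt h]
  · rw [sigma_succ_self]
    simp [dualGen, sigma]

theorem dualGen_mul_succ (i : ZMod k) : dualGen i * dualGen (i + 1) = a k * b k := by
  have h := sigma_mul_succ (k := k) i.val
  have hi := ZMod.val_lt i
  rw [← dualGen_natCast hi.le] at h
  have e : i.val + 2 = (i.val + 1) + 1 := rfl
  rw [e, ← dualGen_natCast (Nat.succ_le_of_lt hi)] at h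
  simpa using h

omit [NeZero k] in
theorem dualGen_zero : dualGen 0 = a k := by simp [dualGen, sigma]

theorem dualGen_one : dualGen 1 = b k := by
  have h := dualGen_mul_succ (0 : ZMod k)
  rw [dualGen_zero, zero_add] at h
  exact mul_left_cancel h

theorem range_dualGen : Set.range dualGen = dualGenerators k := by
  ext x
  constructor
  · rintro ⟨i, rfl⟩
    exact ⟨i.val + 1, ⟨by omega, ZMod.val_lt i⟩, rfl⟩
  · rintro ⟨j, ⟨h1, h2⟩, rfl⟩
    obtain ⟨n, rfl⟩ := Nat.exists_eq_add_of_le' h1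
    exact ⟨(n : ZMod k), dualGen_natCast (by omega)⟩

theorem dualGen_inv_mul (i : ZMod k) (x : DihedralArtin k) :
    (dualGen i)⁻¹ * x = dualGen (i + 1) * ((a k * b k)⁻¹ * x) := by
  rw [← dualGen_mul_succ i]
  group

theorem dualGen_mul_delta (i : ZMod k) :
    dualGen i * (a k * b k) = a k * b k * dualGen (i + 2) := by
  simpa using mul_pow_of_mul_succ dualGen_mul_succ i 1

omit [NeZero k] in
theorem deg_dualGen (i : ZMod k) : deg k (dualGen i) = .ofAdd 1 := by
  rw [dualGen]
  rcases Nat.even_or_odd' i.val with ⟨m, hm | hm⟩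
  · rw [hm, sigma_odd, map_mul, map_mul, map_inv, mul_right_comm]; simp
  · have e : i.val + 1 = 2 * m + 2 := by omega
    rw [e, sigma_even, map_mul, map_mul, map_inv, mul_right_comm]; simp

/-! ### The action on the tree. -/

theorem dualGen_induction {P : DihedralArtin k → Prop} (one : P 1)
    (mul : ∀ i x, P x → P (dualGen i * x)) (inv_mul : ∀ i x, P x → P ((dualGen i)⁻¹ * x))
    (x : DihedralArtin k) : P x := by
  obtain ⟨l, -, hl, rfl⟩ := exists_word_length_eq (closure_artinGenerators k) x
  induction l with
  | nil => exact one
  | cons y l ih =>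
    have h := ih fun z hz => hl z (by simp [hz])
    rw [List.prod_cons]
    have hy := hl y (by simp)
    simp only [artinGenerators, Set.mem_union, Set.mem_insert_iff, Set.mem_singleton_iff,
      Set.mem_inv, inv_eq_iff_eq_inv, ← dualGen_zero, ← dualGen_one] at hy
    rcases hy with (rfl | rfl) | (rfl | rfl)
    exacts [mul _ _ h, mul _ _ h, inv_mul _ _ h, inv_mul _ _ h]

/-- The action of the Artin group on the tree. -/
def treeAction (k : ℕ) : DihedralArtin k →* Equiv.Perm (TreeVertex k) :=
  lift k (dualPerm 0) (dualPerm 1) (altProd_of_mul_succ (s := dualPerm)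
    (d := dualPerm 0 * dualPerm 1) fun i => by
      ext l : 2
      have h := dualPerm_mul 0 l
      rw [zero_add] at h
      rw [dualPerm_mul, h])

theorem treeAction_dualGen (i : ZMod k) : treeAction k (dualGen i) = dualPerm i := by
  have hd : ∀ i : ZMod k, dualPerm i * dualPerm (i + 1) = dualPerm 0 * dualPerm 1 := fun i => by
    ext l : 2
    have h := dualPerm_mul 0 l
    rw [zero_add] at h
    rw [dualPerm_mul, h]
  have h : ∀ n : ℕ, treeAction k (dualGen (n : ZMod k)) = dualPerm (n : ZMod k) := by
    intro n
    induction n with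
    | zero => rw [Nat.cast_zero, dualGen_zero]; exact lift_a _
    | succ n ih =>
      -- Consecutive generators have the same product in the group and in the permutations, so each
      -- image determines the next one by cancellation.
      have h1 := congrArg (treeAction k) (dualGen_mul_succ (n : ZMod k))
      rw [map_mul, map_mul, ih, treeAction, lift_a, lift_b, ← hd n] at h1
      have h2 := mul_left_cancel h1
      rw [← treeAction] at h2
      simpa using h2
  simpa using h i.val

/-- The vertex of the tree to which an element moves the root. -/
def path (x : DihedralArtin k) : List (ZMod k) := (treeAction k x ⟨[], by simp⟩).1

omit [NeZero k] in
theorem isChain_path (x : DihedralArtin k) : (path x).IsChain (· ≠ ·) := Subtype.prop _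

omit [NeZero k] in
@[simp] theorem path_one : path (1 : DihedralArtin k) = [] := by simp [path]

theorem path_dualGen_mul (i : ZMod k) (x : DihedralArtin k) :
    path (dualGen i * x) = toggle i ((path x).map (· + -1)) := by
  simp [path, treeAction_dualGen, dualPerm]

theorem path_dualGen_inv_mul (i : ZMod k) (x : DihedralArtin k) :
    path ((dualGen i)⁻¹ * x) = (toggle i (path x)).map (· + 1) := by
  simp only [path, map_mul, map_inv, treeAction_dualGen]
  rfl

theorem path_delta_mul (x : DihedralArtin k) :
    path (a k * b k * x) = (path x).map (· + -2) := by
  rw [← dualGen_mul_succ 0, path, map_mul, map_mul, treeAction_dualGen, treeAction_dualGen]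
  exact dualPerm_mul 0 _

theorem path_delta_inv_mul (x : DihedralArtin k) :
    path ((a k * b k)⁻¹ * x) = (path x).map (· + 2) := by
  have h := path_delta_mul ((a k * b k)⁻¹ * x)
  rw [mul_inv_cancel_left] at h
  rw [h]
  simp

theorem treeDist_path_mul (g x y : DihedralArtin k) :
    treeDist (path (g * x)) (path (g * y)) = treeDist (path x) (path y) := by
  induction g using dualGen_induction with
  | one => simp
  | mul i g ih =>
    rw [mul_assoc, mul_assoc, path_dualGen_mul, path_dualGen_mul,
      treeDist_toggle i (isChain_map_add _ (isChain_path _)) (isChain_map_add _ (isChain_path _)),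
      treeDist_map_add, ih]
  | inv_mul i g ih =>
    rw [mul_assoc, mul_assoc, path_dualGen_inv_mul, path_dualGen_inv_mul, treeDist_map_add,
      treeDist_toggle i (isChain_path _) (isChain_path _), ih]

theorem length_path_inv_mul (x y : DihedralArtin k) :
    (path (x⁻¹ * y)).length = treeDist (path x) (path y) := by
  rw [← treeDist_path_mul x⁻¹ x y]
  simp

theorem length_path_dualGen_mul (i : ZMod k) (x : DihedralArtin k) :
    (path (dualGen i * x)).length = (path x).length + 1 ∨
      (path x).length = (path (dualGen i * x)).length + 1 := by
  rw [path_dualGen_mul]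
  rcases length_toggle i ((path x).map (· + -1)) with h | h
  · left; rw [h]; simp
  · right; simpa using congrArg List.length h

theorem even_deg_add_length (x : DihedralArtin k) :
    Even ((deg k x).toAdd + (path x).length) := by
  induction x using dualGen_induction with
  | one => simp
  | mul i x ih =>
    rw [map_mul, toAdd_mul, deg_dualGen, toAdd_ofAdd]
    rcases length_path_dualGen_mul i x with h | h <;> [rw [h]; rw [h] at ih] <;> push_cast at * <;> grind
  | inv_mul i x ih =>
    rw [map_mul, map_inv, toAdd_mul, toAdd_inv, deg_dualGen, toAdd_ofAdd]
    have := length_path_dualGen_mul i ((dualGen i)⁻¹ * x)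
    rw [mul_inv_cancel_left] at this
    rcases this with h | h <;> [rw [h] at ih; rw [h]] <;> push_cast at * <;> grind

/-! ### Normal form, tree and degree coordinates, and the dual word length. -/

theorem delta_mul_prod (l : List (ZMod k)) :
    a k * b k * (l.map dualGen).prod =
      ((l.map (· + -2)).map dualGen).prod * (a k * b k) := by
  induction l with
  | nil => simp
  | cons i l ih =>
    have h := dualGen_mul_delta (i + -2)
    rw [neg_add_cancel_right] at h
    rw [List.map_cons, List.map_cons, List.map_cons, List.prod_cons, List.prod_cons,
      mul_assoc (dualGen (i + -2)), ← ih, ← mul_assoc (a k * b k) (dualGen i),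
      ← mul_assoc (dualGen (i + -2)), h]

theorem length_path_prod_le (l : List (ZMod k)) : (path (l.map dualGen).prod).length ≤ l.length := by
  induction l with
  | nil => simp
  | cons i l ih =>
    rw [List.map_cons, List.prod_cons, List.length_cons]
    rcases length_path_dualGen_mul i (l.map dualGen).prod with h | h <;> omega

theorem path_delta_zpow (r : ℤ) : path ((a k * b k) ^ r) = [] := by
  induction r with
  | zero => simp
  | succ n ih => rw [add_comm, zpow_add, zpow_one, path_delta_mul, ih]; rfl
  | pred n ih => rw [sub_eq_neg_add, zpow_add, zpow_neg_one, path_delta_inv_mul, ih]; rfl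

theorem path_mul_delta_zpow (x : DihedralArtin k) (r : ℤ) :
    path (x * (a k * b k) ^ r) = path x := by
  apply eq_of_treeDist_eq_zero
  rw [← length_path_inv_mul, mul_inv_rev, inv_mul_cancel_right, ← zpow_neg, path_delta_zpow]
  rfl

/-- Normal form: every element is a product of as many dual generators as its path has entries,
times a power of the dual Garside element. -/
theorem exists_normal_form (x : DihedralArtin k) : ∃ (l : List (ZMod k)) (r : ℤ),
    l.length = (path x).length ∧ x = (l.map dualGen).prod * (a k * b k) ^ r := by
  have key : ∀ (i : ZMod k) (x : DihedralArtin k), (∃ (l : List (ZMod k)) (r : ℤ),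
      l.length = (path x).length ∧ x = (l.map dualGen).prod * (a k * b k) ^ r) →
      ∃ (l : List (ZMod k)) (r : ℤ), l.length = (path (dualGen i * x)).length ∧
        dualGen i * x = (l.map dualGen).prod * (a k * b k) ^ r := by
    rintro i x ⟨l, r, hl, hx⟩
    have hp : path x = path (l.map dualGen).prod := by rw [hx, path_mul_delta_zpow]
    rcases length_toggle i ((path x).map (· + -1)) with h | h
    · exact ⟨i :: l, r, by rw [path_dualGen_mul, h]; simp [hl], by rw [hx]; simp [mul_assoc]⟩
    · cases l with
      | nil =>
        rw [← path_dualGen_mul] at h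
        have := congrArg List.length h
        simp [← hl] at this
      | cons j l =>
        rw [List.map_cons, List.prod_cons, path_dualGen_mul] at hp
        have h1 := length_path_prod_le l
        rcases length_toggle j ((path (l.map dualGen).prod).map (· + -1)) with h2 | h2
        -- The toggle deletes the head, which forces `j = i + 1`. The first two generators then
        -- merge into δ, which moves to the right end and shifts the remaining indices by `-2`.
        · rw [hp, h2, List.map_cons] at h
          have hj : j = i + 1 := by rw [← (List.cons.inj h).1]; ring
          refine ⟨l.map (· + -2), r + 1, ?_, ?_⟩
          · rw [path_dualGen_mul, hp, h2, List.map_cons, ← (List.cons.inj h).2]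
            rw [hp, h2] at hl
            simpa using hl
          · rw [hx, hj, List.map_cons, List.prod_cons, mul_assoc, ← mul_assoc, dualGen_mul_succ,
              ← mul_assoc, delta_mul_prod, mul_assoc, add_comm, zpow_add, zpow_one]
        -- Impossible: the path of `x` would be shorter than the word `j :: l`.
        · have := congrArg List.length h2
          rw [← hp] at this
          simp at this hl
          omega
  induction x using dualGen_induction with
  | one => exact ⟨[], 0, by simp, by simp⟩
  | mul i x ih => exact key i x ih
  | inv_mul i x ih =>
    rw [dualGen_inv_mul]
    apply key
    obtain ⟨l, r, hl, hx⟩ := ih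
    refine ⟨l.map (· + 2), r - 1, by rw [path_delta_inv_mul]; simp [hl], ?_⟩
    have h := delta_mul_prod (l.map (· + 2))
    rw [inv_mul_eq_iff_eq_mul, ← mul_assoc, h, mul_assoc, sub_eq_neg_add, zpow_add, zpow_neg_one,
      mul_inv_cancel_left, hx]
    simp

/-- An empty path leaves only a power of δ in the normal form, and the degree determines the
exponent. -/
theorem eq_one_of_path_of_deg {x : DihedralArtin k} (hp : path x = []) (hd : deg k x = 1) :
    x = 1 := by
  obtain ⟨l, r, hl, rfl⟩ := exists_normal_form x
  rw [hp, List.length_nil, List.length_eq_zero_iff] at hl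
  subst hl
  have := congrArg Multiplicative.toAdd hd
  simp at this
  simp [this]

theorem eq_of_path_of_deg {x y : DihedralArtin k} (hp : path x = path y)
    (hd : deg k x = deg k y) : x = y := by
  rw [← inv_mul_eq_one]
  apply eq_one_of_path_of_deg
  · rw [← List.length_eq_zero_iff, length_path_inv_mul, hp, treeDist_self]
  · rw [map_mul, map_inv, hd, inv_mul_cancel]

theorem exists_path_deg {l : List (ZMod k)} (hl : l.IsChain (· ≠ ·)) {d : ℤ}
    (hd : Even (d + l.length)) : ∃ x : DihedralArtin k, path x = l ∧ (deg k x).toAdd = d := by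
  obtain ⟨n, hn⟩ : ∃ n, l.length = n := ⟨_, rfl⟩
  induction n generalizing l d with
  | zero =>
    rw [List.length_eq_zero_iff] at hn
    subst hn
    obtain ⟨r, hr⟩ := hd
    refine ⟨(a k * b k) ^ r, path_delta_zpow r, ?_⟩
    simp at hr ⊢
    omega
  | succ n ih =>
    cases l with
    | nil => simp at hn
    | cons i l =>
      -- The tail is shifted by `1` in advance, because `dualGen i` shifts by `-1` before it
      -- toggles.
      obtain ⟨x, hx, hx'⟩ := ih (l := l.map (· + 1)) (d := d - 1) (isChain_map_add _ hl.tail)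
        (by simp only [List.length_map, List.length_cons] at *; push_cast at hd; grind)
        (by simpa using hn)
      refine ⟨dualGen i * x, ?_, by rw [map_mul, toAdd_mul, deg_dualGen, hx', toAdd_ofAdd]; ring⟩
      have h := toggle_toggle i hl
      rw [path_dualGen_mul, hx]
      have e : (l.map (· + 1)).map (· + (-1 : ZMod k)) = l := by simp
      rw [e]
      simpa [toggle] using h

/-- The word length in the dual generators. -/
theorem wordLength_dualGenerators (hk : 2 ≤ k) (x : DihedralArtin k) :
    wordLength (dualGenerators k) x = max (path x).length (deg k x).toAdd.natAbs := by
  have hS := closure_dualGenerators k hk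
  apply le_antisymm
  · obtain ⟨n, hn⟩ : ∃ n, max (path x).length (deg k x).toAdd.natAbs = n := ⟨_, rfl⟩
    rw [hn]
    have mem : ∀ i : ZMod k, dualGen i ∈ dualGenerators k := fun i => by
      rw [← range_dualGen]; exact ⟨i, rfl⟩
    have step : ∀ (x y : DihedralArtin k) (n : ℕ), (y ∈ dualGenerators k ∪ (dualGenerators k)⁻¹) →
        wordLength (dualGenerators k) (y * x) ≤ n → wordLength (dualGenerators k) x ≤ n + 1 := by
      intro x y n hy h
      have h1 := wordLength_mul_le hS y⁻¹ (y * x)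
      rw [inv_mul_cancel_left, wordLength_inv hS] at h1
      have := wordLength_le_one hy
      omega
    induction n generalizing x with
    | zero =>
      have : x = 1 := eq_one_of_path_of_deg (List.length_eq_zero_iff.1 (by omega))
        (Multiplicative.toAdd.injective (Int.natAbs_eq_zero.1 (by omega)))
      simp [this]
    | succ n ih =>
      have hpar := even_deg_add_length x
      have pos : ∀ i, (deg k (dualGen i * x)).toAdd = 1 + (deg k x).toAdd := fun i => by
        rw [map_mul, toAdd_mul, deg_dualGen, toAdd_ofAdd]
      have neg : ∀ i, (deg k ((dualGen i)⁻¹ * x)).toAdd = -1 + (deg k x).toAdd := fun i => by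
        rw [map_mul, toAdd_mul, map_inv, deg_dualGen, toAdd_inv, toAdd_ofAdd]
      -- The sign of the degree decides between a generator and an inverse; its index is free and is
      -- chosen to shorten the path. A coordinate that is zero has to grow to `1`, but by parity the
      -- other coordinate is then at least `2`, so the maximum still drops.
      by_cases hD : 0 < (deg k x).toAdd
      · obtain ⟨i, hi⟩ : ∃ i, (path ((dualGen i)⁻¹ * x)).length = (path x).length - 1 ∨
            (path ((dualGen i)⁻¹ * x)).length = 1 ∧ (path x).length = 0 := by
          cases hp : path x with
          | nil => exact ⟨0, Or.inr ⟨by simp [path_dualGen_inv_mul, hp, toggle], by simp⟩⟩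
          | cons i l => exact ⟨i, Or.inl (by simp [path_dualGen_inv_mul, hp, toggle])⟩
        refine step x _ n (Or.inr (by rw [Set.mem_inv, inv_inv]; exact mem i)) (ih _ ?_)
        rw [neg]
        grind
      · obtain ⟨i, hi⟩ : ∃ i, (path (dualGen i * x)).length = (path x).length - 1 ∨
            (path (dualGen i * x)).length = 1 ∧ (path x).length = 0 := by
          cases hp : path x with
          | nil => exact ⟨0, Or.inr ⟨by simp [path_dualGen_mul, hp, toggle], by simp⟩⟩
          | cons i l => exact ⟨i + -1, Or.inl (by simp [path_dualGen_mul, hp, toggle])⟩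
        refine step x _ n (Or.inl (mem i)) (ih _ ?_)
        rw [pos]
        grind
  · refine max_le ?_ (natAbs_le_wordLength hS (deg k) ?_ x)
    · obtain ⟨l, hl, hl', rfl⟩ := exists_word_length_eq hS x
      rw [← hl]
      clear hl
      induction l with
      | nil => simp
      | cons y l ih =>
        have h1 := ih fun z hz => hl' z (by simp [hz])
        have hy := hl' y (by simp)
        rw [← range_dualGen] at hy
        rw [List.prod_cons, List.length_cons]
        rcases hy with ⟨i, rfl⟩ | ⟨i, hi⟩
        · rcases length_path_dualGen_mul i l.prod with h | h <;> omega
        · have := length_path_dualGen_mul i (y * l.prod)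
          rw [hi, inv_mul_cancel_left] at this
          omega
    · rw [← range_dualGen]
      rintro _ ⟨i, rfl⟩
      rw [deg_dualGen, toAdd_ofAdd]

/-- The metric of the dual generators is the supremum metric of a tree and a line. -/
theorem wordDist_dualGenerators (hk : 2 ≤ k) (x y : DihedralArtin k) :
    wordDist (dualGenerators k) x y =
      max (treeDist (path x) (path y)) ((deg k y).toAdd - (deg k x).toAdd).natAbs := by
  rw [wordDist, wordLength_dualGenerators hk, length_path_inv_mul, map_mul, map_inv, toAdd_mul,
    toAdd_inv, neg_add_eq_sub]

end

end DihedralArtin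

namespace DihedralArtin

/-! ### Horofunctions for the dual generators -/

section Dual

variable {k : ℕ} [NeZero k]

theorem horoEmbed_dualGenerators (hk : 2 ≤ k) (z x : DihedralArtin k) :
    horoEmbed (dualGenerators k) z x =
      ((max (treeDist (path x) (path z) : ℤ) (((deg k z).toAdd - (deg k x).toAdd).natAbs : ℤ) -
        max ((path z).length : ℤ) (((deg k z).toAdd).natAbs : ℤ) : ℤ) : ℝ) := by
  rw [horoEmbed, wordDist_dualGenerators hk, wordDist_dualGenerators hk]
  simp only [path_one, map_one, toAdd_one, sub_zero, treeDist_nil_left]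
  simp only [Int.cast_sub, Int.cast_max, Int.cast_natCast, Nat.cast_max]

/-- A curve of tree vertices and degrees gives a Busemann point, if it is geodesic and the
functions of its elements are eventually constant with the required values. -/
theorem isBusemannPoint_of_curve (hk : 2 ≤ k) {ξ : DihedralArtin k → ℝ}
    (hξ : ξ ∈ horoBoundary (dualGenerators k)) (L : ℕ → List (ZMod k)) (D : ℕ → ℤ)
    (hL : ∀ n, (L n).IsChain (· ≠ ·)) (hLD : ∀ n, Even (D n + (L n).length))
    (hgeo : ∀ m n, max (treeDist (L m) (L (m + n))) (D (m + n) - D m).natAbs = n)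
    (hlim : ∀ x : DihedralArtin k, ∀ᶠ n in atTop,
      ((max (treeDist (path x) (L n) : ℤ) ((D n - (deg k x).toAdd).natAbs : ℤ) -
        max ((L n).length : ℤ) ((D n).natAbs : ℤ) : ℤ) : ℝ) = ξ x) :
    IsBusemannPoint (dualGenerators k) ξ := by
  choose γ hγ hγ' using fun n => exists_path_deg (hL n) (hLD n)
  refine ⟨hξ, γ, fun m n => ?_, tendsto_pi_nhds.2 fun x => ?_⟩
  · rw [wordDist_dualGenerators hk, hγ, hγ, hγ', hγ', hgeo]
  · refine tendsto_const_nhds.congr' ?_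
    filter_upwards [hlim x] with n hn
    rw [horoEmbed_dualGenerators hk, hγ, hγ', hn]

/-- Along an ultrafilter of elements with paths of unbounded length, the paths converge to an
infinite path. -/
theorem exists_limit_path {u : Ultrafilter (DihedralArtin k)}
    (hu : ∀ m : ℕ, ∀ᶠ z in (u : Filter (DihedralArtin k)), m ≤ (path z).length) :
    ∃ ω : ℕ → List (ZMod k), (∀ m, ∀ᶠ z in u, (path z).take m = ω m) ∧
      (∀ m, (ω m).length = m) ∧ (∀ m, (ω m).IsChain (· ≠ ·)) ∧
      ∀ m n, m ≤ n → (ω n).take m = ω m := by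
  have h : ∀ m : ℕ, ∃ l : List (ZMod k), ∀ᶠ z in u, (path z).take m = l := fun m => by
    obtain ⟨l, -, hl⟩ := (Ultrafilter.eventually_exists_mem_iff (f := u)
      (P := fun l z => (path z).take m = l) (List.finite_length_le (ZMod k) m)).1
      (Eventually.of_forall fun z => ⟨_, by simp, rfl⟩)
    exact ⟨l, hl⟩
  choose ω hω using h
  refine ⟨ω, hω, fun m => ?_, fun m => ?_, fun m n hmn => ?_⟩
  · obtain ⟨z, h1, h2⟩ := ((hω m).and (hu m)).exists
    simp [← h1, h2]
  · obtain ⟨z, h1⟩ := (hω m).exists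
    rw [← h1]
    exact (isChain_path z).take m
  · obtain ⟨z, h1, h2⟩ := ((hω m).and (hω n)).exists
    rw [← h1, ← h2, List.take_take, min_eq_left hmn]

omit [NeZero k] in
theorem treeDist_of_take_eq {l m p : List (ZMod k)} (h : m.take l.length = p)
    (hm : l.length ≤ m.length) :
    (treeDist l m : ℤ) = treeDist l p + m.length - l.length := by
  have h1 : l.length ≤ p.length := by simp [← h, hm]
  have h2 : m = p ++ m.drop l.length := by rw [← h, List.take_append_drop]
  have h3 := treeDist_append h1 (m.drop l.length)
  rw [← h2, List.length_drop] at h3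
  omega

theorem finite_setOf_path_deg (M : ℕ) :
    {z : DihedralArtin k | (path z).length ≤ M ∧ (((deg k z).toAdd).natAbs : ℤ) ≤ M}.Finite := by
  refine Set.Finite.of_injOn (f := fun z => (path z, (deg k z).toAdd))
    (t := {l | l.length ≤ M} ×ˢ Set.Icc (-(M : ℤ)) M) ?_ ?_
    ((List.finite_length_le _ M).prod (Set.finite_Icc _ _))
  · rintro z ⟨h1, h2⟩
    exact ⟨h1, Set.mem_Icc.2 (by dsimp only; omega)⟩
  · intro x _ y _ h
    rw [Prod.mk.injEq] at h
    exact eq_of_path_of_deg h.1 (Multiplicative.toAdd.injective h.2)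

omit [NeZero k] in
theorem eventually_notMem_of_finite {S : Set (DihedralArtin k)} {ξ : DihedralArtin k → ℝ}
    (hξ : ξ ∈ horoBoundary S) {u : Ultrafilter (DihedralArtin k)}
    (hu : Tendsto (horoEmbed S) u (𝓝 ξ)) {F : Set (DihedralArtin k)} (hF : F.Finite) :
    ∀ᶠ z in u, z ∉ F := by
  by_contra h
  -- An ultrafilter that contains a finite set is principal, and its limit would be one of the
  -- functions `horoEmbed S z`.
  rw [← Ultrafilter.frequently_iff_eventually, not_frequently] at h
  simp only [not_not] at h
  obtain ⟨z, -, hz⟩ := (Ultrafilter.eventually_exists_mem_iff (f := u)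
    (P := fun y z => z = y) hF).1 (h.mono fun z hz => ⟨z, hz, rfl⟩)
  refine hξ.2 ⟨z, tendsto_nhds_unique (l := (u : Filter (DihedralArtin k))) ?_ hu⟩
  exact tendsto_const_nhds.congr' (hz.mono fun y hy => by rw [hy])

omit [NeZero k] in
theorem eq_of_eventually_eq {S : Set (DihedralArtin k)} {ξ : DihedralArtin k → ℝ}
    {u : Ultrafilter (DihedralArtin k)} (hu : Tendsto (horoEmbed S) u (𝓝 ξ))
    {x : DihedralArtin k} {c : ℝ} (h : ∀ᶠ z in u, horoEmbed S z x = c) : c = ξ x :=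
  tendsto_nhds_unique (l := (u : Filter (DihedralArtin k)))
    (tendsto_const_nhds.congr' (h.mono fun _ hz => hz.symm)) (tendsto_pi_nhds.1 hu x)

omit [NeZero k] in
/-- The sign of the degrees along an ultrafilter. -/
theorem exists_sign (u : Ultrafilter (DihedralArtin k)) : ∃ ε : ℤ, (ε = 1 ∨ ε = -1) ∧
    ∀ᶠ z in u, (((deg k z).toAdd).natAbs : ℤ) = ε * (deg k z).toAdd := by
  rcases Ultrafilter.em u fun z => 0 ≤ (deg k z).toAdd with h | h
  · exact ⟨1, Or.inl rfl, h.mono fun z hz => by omega⟩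
  · exact ⟨-1, Or.inr rfl, h.mono fun z hz => by omega⟩

/-! ### The three kinds of limits for the dual generators. -/

section

variable {ξ : DihedralArtin k → ℝ} {u : Ultrafilter (DihedralArtin k)}

/-- The degree drops out of both maxima, and the limit is the Busemann function of the end `ω` of
the tree. -/
theorem isBusemannPoint_of_path_dominates (hk : 2 ≤ k)
    (hξ : ξ ∈ horoBoundary (dualGenerators k))
    (hu : Tendsto (horoEmbed (dualGenerators k)) u (𝓝 ξ))
    (h : ∀ M : ℕ, ∀ᶠ z in u, (M : ℤ) ≤ (path z).length - (((deg k z).toAdd).natAbs : ℤ)) :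
    IsBusemannPoint (dualGenerators k) ξ := by
  obtain ⟨ω, hω, hlen, hchain, htake⟩ := exists_limit_path (u := u) fun m => (h m).mono fun z hz => by
    omega
  have val : ∀ x, (((treeDist (path x) (ω (path x).length) : ℤ) - (path x).length : ℤ) : ℝ)
      = ξ x := fun x => by
    refine eq_of_eventually_eq hu ?_
    filter_upwards [hω (path x).length, h (2 * (path x).length + (deg k x).toAdd.natAbs)]
      with z h1 h2
    have h4 := treeDist_of_take_eq h1 (by omega)
    rw [horoEmbed_dualGenerators hk]
    congr 1
    omega
  -- The ray follows `ω`; the degree `n % 2` stays bounded and has the required parity.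
  refine isBusemannPoint_of_curve hk hξ ω (fun n => n % 2) hchain (fun n => ?_) (fun m n => ?_)
    fun x => ?_
  · rw [hlen]; grind
  · have h1 := treeDist_of_take_eq (l := ω m) (m := ω (m + n)) (p := ω m)
      (by rw [hlen, htake _ _ (by omega)]) (by rw [hlen, hlen]; omega)
    rw [treeDist_self, hlen, hlen] at h1
    omega
  · filter_upwards [eventually_ge_atTop (2 * (path x).length + (deg k x).toAdd.natAbs + 1)]
      with n hn
    have h1 := treeDist_of_take_eq (l := path x) (m := ω n) (htake _ _ (by omega))
      (by rw [hlen]; omega)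
    rw [hlen] at h1
    rw [← val, hlen]
    congr 1
    omega

/-- The path drops out of both maxima, and the limit is the degree up to sign. -/
theorem isBusemannPoint_of_deg_dominates (hk : 2 ≤ k)
    (hξ : ξ ∈ horoBoundary (dualGenerators k))
    (hu : Tendsto (horoEmbed (dualGenerators k)) u (𝓝 ξ))
    (h : ∀ M : ℕ, ∀ᶠ z in u, (M : ℤ) ≤ (((deg k z).toAdd).natAbs : ℤ) - (path z).length) :
    IsBusemannPoint (dualGenerators k) ξ := by
  obtain ⟨ε, hε, hsign⟩ := exists_sign u
  have val : ∀ x, (((-ε * (deg k x).toAdd : ℤ)) : ℝ) = ξ x := fun x => by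
    refine eq_of_eventually_eq hu ?_
    filter_upwards [hsign, h ((path x).length + (deg k x).toAdd.natAbs)] with z h1 h2
    have h3 := treeDist_le (path x) (path z)
    rw [horoEmbed_dualGenerators hk]
    congr 1
    rcases hε with rfl | rfl <;> omega
  -- The degree runs off to infinity, while the path oscillates along one edge at the root to keep
  -- the parity.
  refine isBusemannPoint_of_curve hk hξ (fun n => if Even n then [] else [0]) (fun n => ε * n)
    (fun n => ?_) (fun n => ?_) (fun m n => ?_) fun x => ?_
  · split_ifs <;> simp
  · split_ifs with hn
    · rcases hε with rfl | rfl <;> simpa using hn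
    · rw [Nat.not_even_iff_odd] at hn
      rcases hε with rfl | rfl <;> simp <;> grind
  · have h1 : (ε * ((m + n : ℕ) : ℤ) - ε * m).natAbs = n := by
      rcases hε with rfl | rfl <;> push_cast <;> omega
    rw [h1, max_eq_right]
    rcases Nat.eq_zero_or_pos n with rfl | hn
    · simp
    · split_ifs with h2 h3 h3 <;> simp <;> omega
  · filter_upwards [eventually_ge_atTop ((path x).length + (deg k x).toAdd.natAbs + 1)] with n hn
    have h3 := treeDist_le (path x) (if Even n then [] else [0])
    have h4 : (if Even n then [] else [(0 : ZMod k)]).length ≤ 1 := by split_ifs <;> simp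
    rw [← val]
    congr 1
    rcases hε with rfl | rfl <;> omega

/-- Both coordinates survive: the limit is a maximum of a tree and a line Busemann function, with
the offset `c` between them. -/
theorem isBusemannPoint_of_balanced (hk : 2 ≤ k)
    (hξ : ξ ∈ horoBoundary (dualGenerators k))
    (hu : Tendsto (horoEmbed (dualGenerators k)) u (𝓝 ξ)) (c : ℤ)
    (h : ∀ᶠ z in u, (path z).length - (((deg k z).toAdd).natAbs : ℤ) = c) :
    IsBusemannPoint (dualGenerators k) ξ := by
  obtain ⟨ε, hε, hsign⟩ := exists_sign u
  -- Only finitely many elements have both coordinates bounded, and the coordinates differ by the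
  -- constant `c`, so both tend to infinity.
  have hinf : ∀ M : ℕ, ∀ᶠ z in u, M ≤ (path z).length ∧ (M : ℤ) ≤ (((deg k z).toAdd).natAbs : ℤ) := fun M => by
    filter_upwards [h, eventually_notMem_of_finite hξ hu (finite_setOf_path_deg (M + c.natAbs))]
      with z h1 h2
    simp only [not_and_or] at h2
    omega
  obtain ⟨ω, hω, hlen, hchain, htake⟩ := exists_limit_path fun m => (hinf m).mono fun z hz => hz.1
  have hc : Even c := by
    obtain ⟨z, h1, h2⟩ := (h.and hsign).exists
    have h3 := even_deg_add_length z
    rw [← h1]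
    rcases hε with rfl | rfl <;> grind
  have val : ∀ x, (((max ((treeDist (path x) (ω (path x).length) : ℤ) - (path x).length + c)
      (-ε * (deg k x).toAdd) - max c 0 : ℤ)) : ℝ) = ξ x := fun x => by
    refine eq_of_eventually_eq hu ?_
    filter_upwards [hω (path x).length, hsign, h, hinf ((path x).length + (deg k x).toAdd.natAbs)]
      with z h1 h2 h3 h4
    have h5 := treeDist_of_take_eq h1 (by omega)
    rw [horoEmbed_dualGenerators hk]
    congr 1
    rcases hε with rfl | rfl <;> omega
  -- Both coordinates grow with unit speed, and the starting values `c.toNat` and `(-c).toNat` make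
  -- their difference `c`. The parity condition holds because `c` is even.
  refine isBusemannPoint_of_curve hk hξ (fun n => ω (n + c.toNat)) (fun n => ε * (n + (-c).toNat))
    (fun n => hchain _) (fun n => ?_) (fun m n => ?_) fun x => ?_
  · rw [hlen]
    rcases hε with rfl | rfl <;> grind
  · have h1 := treeDist_of_take_eq (l := ω (m + c.toNat)) (m := ω (m + n + c.toNat))
      (p := ω (m + c.toNat)) (by rw [hlen, htake _ _ (by omega)]) (by rw [hlen, hlen]; omega)
    rw [treeDist_self, hlen, hlen] at h1
    rcases hε with rfl | rfl <;> push_cast at * <;> omega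
  · filter_upwards [eventually_ge_atTop ((path x).length + (deg k x).toAdd.natAbs)] with n hn
    have h1 := treeDist_of_take_eq (l := path x) (m := ω (n + c.toNat)) (htake _ _ (by omega))
      (by rw [hlen]; omega)
    rw [hlen] at h1
    rw [← val, hlen]
    congr 1
    rcases hε with rfl | rfl <;> omega

end

theorem isBusemannPoint_dualGenerators (hk : 2 ≤ k) {ξ : DihedralArtin k → ℝ}
    (hξ : ξ ∈ horoBoundary (dualGenerators k)) : IsBusemannPoint (dualGenerators k) ξ := by
  obtain ⟨u, hu⟩ := exists_ultrafilter_tendsto hξ.1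
  by_cases h1 : ∀ M : ℕ, ∀ᶠ z in u, (M : ℤ) ≤ (path z).length - (((deg k z).toAdd).natAbs : ℤ)
  · exact isBusemannPoint_of_path_dominates hk hξ hu h1
  by_cases h2 : ∀ M : ℕ, ∀ᶠ z in u, (M : ℤ) ≤ (((deg k z).toAdd).natAbs : ℤ) - (path z).length
  · exact isBusemannPoint_of_deg_dominates hk hξ hu h2
  push Not at h1 h2
  obtain ⟨M, hM⟩ := h1
  obtain ⟨N, hN⟩ := h2
  obtain ⟨c, -, hc⟩ := (Ultrafilter.eventually_exists_mem_iff (f := u)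
    (P := fun c z => ((path z).length : ℤ) - (((deg k z).toAdd).natAbs : ℤ) = c)
    (Set.finite_Icc (-(N : ℤ)) M)).1 (by
      filter_upwards [hM, hN] with z h1 h2
      exact ⟨_, ⟨by omega, by omega⟩, rfl⟩)
  exact isBusemannPoint_of_balanced hk hξ hu c hc

end Dual

end DihedralArtin

/-! ### An action of the Artin group on a tree of polygons

A state `(d, l)` records a path of polygons: the entry `i` of `l` says that the path leaves the
polygon at its position `i + 1`, and `d` is the letter that moves forward in the last polygon. The
alphabet is `Bool`, with `false` for `a` and `true` for `b`. -/

section Polygons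

variable {p : ℕ}

/-- The action of a letter on states. -/
def advance (d : Bool) : Bool × List (Fin (p + 2)) → Bool × List (Fin (p + 2))
  | (e, l) => if d = e then
      match l with
      | [] => (!d, [])
      | i :: l => if h : i.1 + 1 < p + 2 then (!d, ⟨i.1 + 1, h⟩ :: l) else (d, l)
    else (e, 0 :: l)

/-- The action of the inverse of a letter on states. -/
def retreat (d : Bool) : Bool × List (Fin (p + 2)) → Bool × List (Fin (p + 2))
  | (e, l) => if d = e then (d, Fin.last (p + 1) :: l) else
      match l with
      | [] => (d, [])
      | i :: l => if i.1 = 0 then (e, l) else (d, ⟨i.1 - 1, by omega⟩ :: l)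

/-- The permutation of the states given by a letter. -/
def polygonPerm (p : ℕ) (d : Bool) : Equiv.Perm (Bool × List (Fin (p + 2))) where
  toFun := advance d
  invFun := retreat d
  left_inv := by
    rintro ⟨e, l⟩
    by_cases hd : d = e
    · subst hd
      cases l with
      | nil => simp [advance, retreat]
      | cons i l =>
        by_cases h : i.1 + 1 < p + 2
        · simp [advance, retreat, h]
        · have : i = Fin.last (p + 1) := Fin.ext (by rw [Fin.val_last]; omega)
          simp [advance, retreat, this]
    · simp [advance, retreat, hd]
  right_inv := by
    rintro ⟨e, l⟩
    by_cases hd : d = e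
    · simp [advance, retreat, hd]
    · have he : (!d) = e := by cases d <;> cases e <;> simp_all
      cases l with
      | nil => simp [advance, retreat, hd, he]
      | cons i l =>
        by_cases h : i.1 = 0
        · have : i = 0 := Fin.ext h
          simp [advance, retreat, hd, this]
        · have h1 : i.1 - 1 + 1 = i.1 := by omega
          simp [advance, retreat, hd, h, h1, he]

/-- The action of `n` alternating letters, of which `d` acts first. -/
def alternate (d : Bool) : ℕ → Bool × List (Fin (p + 2)) → Bool × List (Fin (p + 2))
  | 0, x => x
  | n + 1, x => alternate (!d) n (advance d x)

theorem alternate_add (d : Bool) (m n : ℕ) (x : Bool × List (Fin (p + 2))) :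
    alternate d (m + n) x = alternate (xor d m.bodd) n (alternate d m x) := by
  induction m generalizing d x with
  | zero => simp [alternate]
  | succ m ih =>
    rw [Nat.add_right_comm, alternate, ih, alternate]
    simp

/-- The position in the base polygon is not recorded, so walking around it only exchanges the
letters. -/
theorem alternate_nil (d : Bool) (n : ℕ) :
    alternate d n (d, ([] : List (Fin (p + 2)))) = (xor d n.bodd, []) := by
  induction n generalizing d with
  | zero => simp [alternate]
  | succ n ih =>
    rw [alternate, advance, if_pos rfl, ih]
    simp

theorem alternate_cons (d : Bool) (n i : ℕ) (h : i + n < p + 2) (l : List (Fin (p + 2))) :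
    alternate d n (d, ⟨i, by omega⟩ :: l) = (xor d n.bodd, ⟨i + n, h⟩ :: l) := by
  induction n generalizing d i with
  | zero => simp [alternate]
  | succ n ih =>
    have h1 : i + 1 < p + 2 := by omega
    simp only [alternate, advance, if_true, h1, dif_pos]
    rw [ih _ _ (by omega)]
    simp [Nat.add_assoc, Nat.add_comm 1]

theorem alternate_pop (d : Bool) (i n : ℕ) (h : i + n = p + 1) (l : List (Fin (p + 2))) :
    alternate d (n + 1) (d, ⟨i, by omega⟩ :: l) = (xor d n.bodd, l) := by
  rw [alternate_add, alternate_cons d n i (by omega)]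
  simp [alternate, advance, h]

theorem alternate_push (d : Bool) (n : ℕ) (h : n < p + 2) (l : List (Fin (p + 2))) :
    alternate d (n + 1) (!d, l) = (xor (!d) n.bodd, ⟨n, h⟩ :: l) := by
  have h1 := alternate_cons (!d) n 0 (by omega) l
  simp only [Nat.zero_add] at h1
  have h2 : advance d (!d, l) = (!d, 0 :: l) := by simp [advance]
  rw [alternate, h2, ← h1]
  rfl

/-- The `k = p + 3` alternating letters go once around a polygon. If `d` moves forward in the
current one, the walk leaves it where it was entered and climbs again to the same position;
otherwise it goes around a new polygon and drops it. Either way the result does not depend on `d`.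
-/
theorem alternate_full (d e : Bool) (l : List (Fin (p + 2))) :
    alternate d (p + 3) (e, l) = (xor e (p + 3).bodd, l) := by
  by_cases hd : d = e
  · subst hd
    cases l with
    | nil => exact alternate_nil d _
    | cons i l =>
      obtain ⟨i, hi⟩ := i
      obtain ⟨n, hn⟩ := Nat.exists_eq_add_of_le (Nat.lt_succ_iff.1 hi)
      have e1 : p + 3 = (n + 1) + (i + 1) := by omega
      have h1 := alternate_push (xor d (n + 1).bodd) i hi l
      rw [e1, alternate_add, alternate_pop d i n (by omega)]
      have e2 : xor d n.bodd = !(xor d (n + 1).bodd) := by simp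
      rw [e2, h1]
      simp
  · have he : e = !d := by cases d <;> cases e <;> simp_all
    subst he
    have h1 := alternate_pop (!d) 0 (p + 1) (by omega) l
    have h2 : advance d (!d, l) = (!d, 0 :: l) := by simp [advance]
    rw [alternate, h2]
    refine h1.trans ?_
    simp

/-- The rightmost factor acts first, whence the starting letter `xor d (n + 1).bodd`. -/
theorem altProd_polygonPerm_apply (d : Bool) (n : ℕ) (x : Bool × List (Fin (p + 2))) :
    altProd (polygonPerm p d) (polygonPerm p (!d)) n x = alternate (xor d (n + 1).bodd) n x := by
  induction n generalizing d with
  | zero => rfl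
  | succ n ih =>
    have h := ih (!d)
    rw [Bool.not_not] at h
    rw [altProd, Equiv.Perm.mul_apply, h, alternate_add]
    simp [alternate, polygonPerm]

theorem altProd_polygonPerm :
    altProd (polygonPerm p false) (polygonPerm p true) (p + 3) =
      altProd (polygonPerm p true) (polygonPerm p false) (p + 3) := by
  ext1 ⟨e, l⟩
  have h1 := altProd_polygonPerm_apply false (p + 3) (e, l)
  have h2 := altProd_polygonPerm_apply true (p + 3) (e, l)
  rw [alternate_full] at h1 h2
  exact h1.trans h2.symm

/-- A weight on the states: the first `n` polygons are weighted differently from the others. -/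
def potential (n : ℕ) : List (Fin (p + 2)) → ℤ
  | [] => 0
  | i :: l => potential n l +
      if l.length < n then (p : ℤ) + 2 - i.1 else if i.1 = 0 then (p : ℤ) + 2 else p + 4

/-- With `k = p + 3`, the weights are such that no letter raises weight plus degree by more than
`k`. A polygon entered forwards adds `k - 1` to the weight and `1` to the degree. The jump by `2`
from position `0` in the distant polygons is harmless because `k ≥ 3`. -/
theorem potential_advance (n : ℕ) (d : Bool) (x : Bool × List (Fin (p + 2))) :
    potential n (advance d x).2 + 1 ≤ potential n x.2 + (p + 3) := by
  obtain ⟨e, l⟩ := x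
  by_cases hd : d = e
  · cases l with
    | nil => simp [advance, hd]; omega
    | cons i l =>
      by_cases h : i.1 + 1 < p + 2
      · simp only [advance, hd, if_true, dif_pos h, potential]
        grind
      · simp only [advance, hd, if_true, dif_neg h, potential]
        grind
  · simp only [advance, hd, if_false, potential, Fin.val_zero, if_true]
    split_ifs <;> omega

theorem potential_retreat (n : ℕ) (d : Bool) (x : Bool × List (Fin (p + 2))) :
    potential n (retreat d x).2 - 1 ≤ potential n x.2 + (p + 3) := by
  obtain ⟨e, l⟩ := x
  by_cases hd : d = e
  · simp only [retreat, hd, if_true, potential, Fin.val_last]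
    split_ifs <;> push_cast <;> omega
  · cases l with
    | nil => simp [retreat, hd]; omega
    | cons i l =>
      by_cases h : i.1 = 0
      · simp only [retreat, hd, if_false, h, if_true, potential]
        split_ifs <;> push_cast <;> omega
      · simp only [retreat, hd, if_false, h, potential]
        split_ifs <;> push_cast <;> omega

/-- Among the first `n` polygons the weight grows by at most one with a backward step, which the
degree compensates. So inverse letters gain nothing near the base. -/
theorem potential_retreat_of_length_lt {n : ℕ} (d : Bool) {x : Bool × List (Fin (p + 2))}
    (hx : x.2.length < n) : potential n (retreat d x).2 - 1 ≤ potential n x.2 := by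
  obtain ⟨e, l⟩ := x
  dsimp only at hx
  by_cases hd : d = e
  · simp only [retreat, hd, if_true, potential, Fin.val_last, hx]
    push_cast
    omega
  · cases l with
    | nil => simp [retreat, hd]
    | cons i l =>
      rw [List.length_cons] at hx
      have hl : l.length < n := by omega
      by_cases h : i.1 = 0
      · simp only [retreat, hd, if_false, h, if_true, potential, hl]
        push_cast
        omega
      · simp only [retreat, hd, if_false, h, potential, hl, if_true]
        omega

theorem length_advance_le (d : Bool) (x : Bool × List (Fin (p + 2))) :
    (advance d x).2.length ≤ x.2.length + 1 := by
  obtain ⟨e, l⟩ := x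
  simp only [advance]
  split_ifs
  · cases l with
    | nil => simp
    | cons i l => dsimp only; split_ifs <;> simp; omega
  · simp

theorem length_retreat_le (d : Bool) (x : Bool × List (Fin (p + 2))) :
    (retreat d x).2.length ≤ x.2.length + 1 := by
  obtain ⟨e, l⟩ := x
  simp only [retreat]
  split_ifs
  · simp
  · cases l with
    | nil => simp
    | cons i l => dsimp only; split_ifs <;> simp; omega

end Polygons

/-! ### Lower bounds for the Artin word length from the potential. -/

namespace DihedralArtin

section Polygons

variable {p : ℕ}

/-- The action of the Artin group on the states. -/
def polygonAction (p : ℕ) : DihedralArtin (p + 3) →* Equiv.Perm (Bool × List (Fin (p + 2))) :=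
  lift (p + 3) (polygonPerm p false) (polygonPerm p true) altProd_polygonPerm

/-- The path of polygons to which an element moves the base. -/
def polygonPath (x : DihedralArtin (p + 3)) : List (Fin (p + 2)) :=
  (polygonAction p x (true, [])).2

/-- The potential of an element: the weight of its path of polygons, plus its degree. -/
def totalPotential (n : ℕ) (x : DihedralArtin (p + 3)) : ℤ :=
  potential n (polygonPath x) + (deg (p + 3) x).toAdd

theorem polygonAction_letter {y : DihedralArtin (p + 3)}
    (hy : y ∈ artinGenerators (p + 3) ∪ (artinGenerators (p + 3))⁻¹) :
    ∃ d : Bool, ((deg (p + 3) y).toAdd = 1 ∧ ∀ x, polygonAction p y x = advance d x) ∨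
      ((deg (p + 3) y).toAdd = -1 ∧ ∀ x, polygonAction p y x = retreat d x) := by
  simp only [artinGenerators, Set.mem_union, Set.mem_insert_iff, Set.mem_singleton_iff,
    Set.mem_inv, inv_eq_iff_eq_inv] at hy
  rcases hy with (rfl | rfl) | (rfl | rfl)
  · exact ⟨false, Or.inl ⟨by simp, fun x => by rw [polygonAction, lift_a]; rfl⟩⟩
  · exact ⟨true, Or.inl ⟨by simp, fun x => by rw [polygonAction, lift_b]; rfl⟩⟩
  · exact ⟨false, Or.inr ⟨by simp, fun x => by rw [polygonAction, map_inv, lift_a]; rfl⟩⟩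
  · exact ⟨true, Or.inr ⟨by simp, fun x => by rw [polygonAction, map_inv, lift_b]; rfl⟩⟩

theorem totalPotential_letter_mul_le (n : ℕ) {y : DihedralArtin (p + 3)}
    (hy : y ∈ artinGenerators (p + 3) ∪ (artinGenerators (p + 3))⁻¹) (x : DihedralArtin (p + 3)) :
    totalPotential n (y * x) ≤ totalPotential n x + (p + 3) := by
  obtain ⟨d, ⟨h1, h2⟩ | ⟨h1, h2⟩⟩ := polygonAction_letter hy
  · have := potential_advance n d (polygonAction p x (true, []))
    simp only [totalPotential, polygonPath, map_mul, Equiv.Perm.mul_apply, toAdd_mul, h1, h2]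
    omega
  · have := potential_retreat n d (polygonAction p x (true, []))
    simp only [totalPotential, polygonPath, map_mul, Equiv.Perm.mul_apply, toAdd_mul, h1, h2]
    omega

theorem totalPotential_mul_le (n : ℕ) (w x : DihedralArtin (p + 3)) :
    totalPotential n (w * x) ≤
      totalPotential n x + (p + 3) * wordLength (artinGenerators (p + 3)) w := by
  obtain ⟨l, hl, hl', rfl⟩ := exists_word_length_eq (closure_artinGenerators (p + 3)) w
  rw [← hl]
  clear hl
  induction l with
  | nil => simp
  | cons y l ih =>
    have h1 := ih fun z hz => hl' z (by simp [hz])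
    have h2 := totalPotential_letter_mul_le n (hl' y (by simp)) (l.prod * x)
    rw [List.prod_cons, mul_assoc, List.length_cons]
    push_cast
    linarith

/-- Near the base, the potential is controlled by the number of positive letters. -/
theorem two_mul_totalPotential_le {n : ℕ} {x : DihedralArtin (p + 3)}
    (hx : wordLength (artinGenerators (p + 3)) x ≤ n) :
    2 * totalPotential n x ≤ (p + 3) * (wordLength (artinGenerators (p + 3)) x +
      (deg (p + 3) x).toAdd) := by
  obtain ⟨l, hl, hl', rfl⟩ := exists_word_length_eq (closure_artinGenerators (p + 3)) x
  rw [← hl] at hx ⊢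
  clear hl
  -- The length bound keeps every intermediate state among the first `n` polygons. There only
  -- positive letters contribute, at most `p + 3` each, and length plus degree counts them twice.
  suffices h : (polygonPath l.prod).length ≤ l.length ∧ 2 * totalPotential n l.prod ≤
      (p + 3) * (l.length + (deg (p + 3) l.prod).toAdd) from h.2
  induction l with
  | nil => simp [polygonPath, totalPotential, potential]
  | cons y l ih =>
    rw [List.length_cons] at hx
    obtain ⟨h1, h2⟩ := ih (fun z hz => hl' z (by simp [hz])) (by omega)
    obtain ⟨d, ⟨h3, h4⟩ | ⟨h3, h4⟩⟩ := polygonAction_letter (hl' y (by simp))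
    · have h5 := potential_advance n d (polygonAction p l.prod (true, []))
      have h6 := length_advance_le d (polygonAction p l.prod (true, []))
      simp only [totalPotential, polygonPath, List.prod_cons, map_mul, Equiv.Perm.mul_apply,
        toAdd_mul, h3, h4, List.length_cons] at *
      push_cast
      exact ⟨by omega, by linarith⟩
    · have h5 := potential_retreat_of_length_lt (n := n) d
        (x := polygonAction p l.prod (true, [])) (by simp only [polygonPath] at h1; omega)
      have h6 := length_retreat_le d (polygonAction p l.prod (true, []))
      simp only [totalPotential, polygonPath, List.prod_cons, map_mul, Equiv.Perm.mul_apply,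
        toAdd_mul, h3, h4, List.length_cons] at *
      push_cast
      exact ⟨by omega, by linarith⟩

/-- All `2 * n` letters achieve the maximal gain `k = p + 3`: each `a` opens a near polygon of
weight `k - 1` with degree `1`, and each `b⁻¹` a distant polygon of weight `k + 1` with degree `-1`.
-/
theorem totalPotential_pow_mul_pow (n : ℕ) :
    totalPotential n ((b (p + 3))⁻¹ ^ n * a (p + 3) ^ n) = 2 * n * (p + 3) := by
  have h1 : ∀ m : ℕ, polygonAction p (a (p + 3) ^ m) (true, []) = (true, List.replicate m 0) := by
    intro m
    induction m with
    | zero => simp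
    | succ m ih =>
      rw [pow_succ', map_mul, Equiv.Perm.mul_apply, ih, polygonAction, lift_a]
      simp [polygonPerm, advance, List.replicate_succ]
  have h2 : ∀ m : ℕ, polygonAction p ((b (p + 3))⁻¹ ^ m) (true, List.replicate n 0) =
      (true, List.replicate m (Fin.last (p + 1)) ++ List.replicate n 0) := by
    intro m
    induction m with
    | zero => simp
    | succ m ih =>
      have e : ∀ x, (polygonPerm p true)⁻¹ x = retreat true x := fun _ => rfl
      rw [pow_succ', map_mul, Equiv.Perm.mul_apply, ih, polygonAction, map_inv, lift_b, e]
      simp [retreat, List.replicate_succ]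
  have h3 : ∀ m ≤ n, potential n (List.replicate m (0 : Fin (p + 2))) = m * (p + 2) := by
    intro m hm
    induction m with
    | zero => simp [potential]
    | succ m ih =>
      rw [List.replicate_succ, potential, ih (by omega), List.length_replicate,
        if_pos (by omega)]
      push_cast
      simp
      ring
  have h4 : ∀ m : ℕ, potential n (List.replicate m (Fin.last (p + 1)) ++
      List.replicate n (0 : Fin (p + 2))) = m * (p + 4) + n * (p + 2) := by
    intro m
    induction m with
    | zero => simp [h3 n le_rfl]
    | succ m ih =>
      rw [List.replicate_succ, List.cons_append, potential, ih, if_neg (by simp),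
        if_neg (by simp)]
      push_cast
      ring
  rw [totalPotential, polygonPath, map_mul, Equiv.Perm.mul_apply, h1, h2, h4]
  simp
  ring

/-- The product climbs from the potential of `y⁻¹`, which is small near the base, to that of b⁻ⁿaⁿ,
which is `2 * n * (p + 3)`, with a gain of at most `p + 3` per letter. -/
theorem le_wordLength_artinGenerators {n : ℕ} {y : DihedralArtin (p + 3)}
    (hy : wordLength (artinGenerators (p + 3)) y ≤ n) :
    (4 * n : ℤ) ≤ wordLength (artinGenerators (p + 3)) y - (deg (p + 3) y).toAdd +
      2 * wordLength (artinGenerators (p + 3)) ((b (p + 3))⁻¹ ^ n * a (p + 3) ^ n * y) := by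
  have hS := closure_artinGenerators (p + 3)
  rw [← wordLength_inv hS y] at hy
  have h1 := two_mul_totalPotential_le hy
  have h2 := totalPotential_mul_le n ((b (p + 3))⁻¹ ^ n * a (p + 3) ^ n * y) y⁻¹
  rw [mul_inv_cancel_right, totalPotential_pow_mul_pow] at h2
  rw [wordLength_inv hS, map_inv, toAdd_inv] at h1
  have h3 : (0 : ℤ) < p + 3 := by positivity
  refine le_of_mul_le_mul_left ?_ h3
  linarith

end Polygons

/-! ### Word lengths of products with powers of the Garside element -/

section Garside

variable {k : ℕ}

theorem altProd_succ_eq {H : Type*} [Group H] (s t : H) (n : ℕ) :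
    altProd s t (n + 1) = altProd s t n * if Even n then s else t := by
  induction n generalizing s t with
  | zero => simp [altProd]
  | succ n ih =>
    rw [altProd, ih, altProd, mul_assoc]
    by_cases h : Even n <;> simp [h, Nat.even_add_one]

/-- The Garside element. -/
def garside (k : ℕ) : DihedralArtin k := altProd (a k) (b k) k

/-- Prepend `s` to the word for Δ that begins with the other letter: the alternating word of length
`k + 1` is also Δ followed by its last letter. -/
theorem garside_conj_mem {x : DihedralArtin k} (hx : x ∈ artinGenerators k) :
    (garside k)⁻¹ * x * garside k ∈ artinGenerators k := by
  have key : ∀ s t : DihedralArtin k, garside k = altProd s t k → garside k = altProd t s k →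
      s ∈ artinGenerators k → t ∈ artinGenerators k →
      (garside k)⁻¹ * s * garside k ∈ artinGenerators k := by
    intro s t h1 h2 hs ht
    have h3 : s * garside k = garside k * if Even k then s else t := by
      calc s * garside k = s * altProd t s k := by rw [h2]
        _ = altProd s t (k + 1) := rfl
        _ = _ := by rw [altProd_succ_eq, ← h1]
    rw [mul_assoc, h3, inv_mul_cancel_left]
    split_ifs <;> assumption
  have ha : a k ∈ artinGenerators k := by simp [artinGenerators]
  have hb : b k ∈ artinGenerators k := by simp [artinGenerators]
  rcases hx with rfl | rfl
  · exact key _ _ rfl altProd_a_b ha hb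
  · exact key _ _ altProd_a_b rfl hb ha

theorem wordLength_garside_conj_le (x : DihedralArtin k) (n : ℕ) :
    wordLength (artinGenerators k) ((garside k ^ n)⁻¹ * x * garside k ^ n) ≤
      wordLength (artinGenerators k) x := by
  have h : ∀ x : DihedralArtin k, wordLength (artinGenerators k)
      ((garside k)⁻¹ * x * garside k) ≤ wordLength (artinGenerators k) x := by
    intro x
    obtain ⟨l, hl, hl', rfl⟩ := exists_word_length_eq (closure_artinGenerators k) x
    have e : (garside k)⁻¹ * l.prod * garside k =
        (l.map fun y => (garside k)⁻¹ * y * garside k).prod := by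
      have h := map_list_prod (MulAut.conj (garside k)⁻¹) l
      rw [MulAut.conj_apply, inv_inv] at h
      rw [h]
      congr 1
      exact List.map_congr_left fun y _ => by rw [MulAut.conj_apply, inv_inv]
    rw [← hl, e]
    refine (wordLength_prod_le ?_).trans (by simp)
    simp only [List.mem_map]
    rintro _ ⟨y, hy, rfl⟩
    rcases hl' y hy with h | h
    · exact Or.inl (garside_conj_mem h)
    · right
      have := garside_conj_mem h
      simpa [mul_assoc] using this
  induction n with
  | zero => simp
  | succ n ih =>
    have e : (garside k ^ (n + 1))⁻¹ * x * garside k ^ (n + 1) =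
        (garside k)⁻¹ * ((garside k ^ n)⁻¹ * x * garside k ^ n) * garside k := by
      rw [pow_succ]; simp only [mul_inv_rev, mul_assoc]
    rw [e]
    exact (h _).trans ih

theorem wordLength_a_le : wordLength (artinGenerators k) (a k) ≤ 1 :=
  wordLength_le_one (Or.inl (by simp [artinGenerators]))

theorem wordLength_b_le : wordLength (artinGenerators k) (b k) ≤ 1 :=
  wordLength_le_one (Or.inl (by simp [artinGenerators]))

theorem wordLength_altProd_le {G : Type*} [Group G] {S : Set G} (hS : Subgroup.closure S = ⊤)
    {s t : G} (hs : wordLength S s ≤ 1) (ht : wordLength S t ≤ 1) (n : ℕ) :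
    wordLength S (altProd s t n) ≤ n := by
  induction n generalizing s t with
  | zero => simp [altProd]
  | succ n ih =>
    have h1 := wordLength_mul_le hS s (altProd t s n)
    have h2 := ih ht hs
    rw [altProd]
    omega

/-- Each `b⁻¹` cancels the first letter of one Garside element, since the conjugations needed to
bring them together do not increase length. -/
theorem wordLength_pow_mul_garside_pow_le (hk : 1 ≤ k) (s : ℕ) :
    wordLength (artinGenerators k) ((b k)⁻¹ ^ s * garside k ^ s) ≤ s * (k - 1) := by
  have hS := closure_artinGenerators k
  have h1 : wordLength (artinGenerators k) ((b k)⁻¹ * garside k) ≤ k - 1 := by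
    have e : (b k)⁻¹ * garside k = altProd (a k) (b k) (k - 1) := by
      have e1 : altProd (b k) (a k) k = altProd (b k) (a k) (k - 1 + 1) :=
        congrArg _ (Nat.sub_add_cancel hk).symm
      rw [garside, altProd_a_b, e1, altProd, inv_mul_cancel_left]
    rw [e]
    exact wordLength_altProd_le hS wordLength_a_le wordLength_b_le _
  induction s with
  | zero => simp
  | succ s ih =>
    have e : (b k)⁻¹ ^ (s + 1) * garside k ^ (s + 1) = (b k)⁻¹ ^ s * garside k ^ s *
        ((garside k ^ s)⁻¹ * ((b k)⁻¹ * garside k) * garside k ^ s) := by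
      rw [pow_succ, pow_succ' (garside k)]
      simp only [mul_assoc, mul_inv_cancel_left]
    rw [e, Nat.succ_mul]
    exact (wordLength_mul_le hS _ _).trans
      (add_le_add ih ((wordLength_garside_conj_le _ _).trans h1))

/-- The power of Δ moves to the left of `a ^ n` and absorbs `s` of the letters `b⁻¹`, for a total of
`(n - s) + s * (k - 1) + n`. -/
theorem wordLength_mul_garside_pow_le (hk : 2 ≤ k) {s n : ℕ} (hsn : s ≤ n) :
    wordLength (artinGenerators k) ((b k)⁻¹ ^ n * a k ^ n * garside k ^ s) ≤
      2 * n + s * (k - 2) := by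
  have hS := closure_artinGenerators k
  obtain ⟨m, rfl⟩ := Nat.exists_eq_add_of_le' hsn
  have e : (b k)⁻¹ ^ (m + s) * a k ^ (m + s) * garside k ^ s =
      (b k)⁻¹ ^ m * ((b k)⁻¹ ^ s * garside k ^ s) *
        ((garside k ^ s)⁻¹ * a k ^ (m + s) * garside k ^ s) := by
    rw [pow_add (b k)⁻¹]
    simp only [mul_assoc, mul_inv_cancel_left]
  have h1 := wordLength_pow_le hS (b k)⁻¹ m
  have h2 := wordLength_pow_le hS (a k) (m + s)
  have h3 := wordLength_garside_conj_le (a k ^ (m + s)) s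
  have h4 := wordLength_pow_mul_garside_pow_le (k := k) (by omega) s
  have h5 := wordLength_mul_le hS ((b k)⁻¹ ^ m * ((b k)⁻¹ ^ s * garside k ^ s))
        ((garside k ^ s)⁻¹ * a k ^ (m + s) * garside k ^ s)
  have h6 := wordLength_mul_le hS ((b k)⁻¹ ^ m) ((b k)⁻¹ ^ s * garside k ^ s)
  rw [wordLength_inv hS] at h1
  have h7 := Nat.mul_le_mul_left m (wordLength_b_le (k := k))
  have h8 := Nat.mul_le_mul_left (m + s) (wordLength_a_le (k := k))
  obtain ⟨q, rfl⟩ := Nat.exists_eq_add_of_le' hk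
  have e1 : s * (q + 2 - 1) = s * (q + 2 - 2) + s := by
    rw [show q + 2 - 1 = q + 1 by omega, Nat.add_sub_cancel]; ring
  rw [e]
  omega

theorem deg_garside : deg k (garside k) = .ofAdd (k : ℤ) := by
  have h : ∀ n : ℕ, altProd (Multiplicative.ofAdd (1 : ℤ)) (.ofAdd 1) n = .ofAdd (n : ℤ) := by
    intro n
    induction n with
    | zero => rfl
    | succ n ih => rw [altProd, ih, ← ofAdd_add, add_comm]; rfl
  rw [garside, map_altProd, deg_a, deg_b, h]

end Garside

/-- A limit of the functions of the elements `a⁻ⁿ bⁿ` is a horofunction for the Artin generators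
that is not a Busemann point. -/
theorem exists_not_isBusemannPoint (p : ℕ) : ∃ ξ ∈ horoBoundary (artinGenerators (p + 3)),
    ¬ IsBusemannPoint (artinGenerators (p + 3)) ξ := by
  have hS := closure_artinGenerators (p + 3)
  set S := artinGenerators (p + 3) with hSdef
  set w : ℕ → DihedralArtin (p + 3) := fun n => (b (p + 3))⁻¹ ^ n * a (p + 3) ^ n with hw
  have hlen : ∀ n, wordLength S (w n) = 2 * n := fun n => by
    have h1 := le_wordLength_artinGenerators (p := p) (n := n) (y := 1) (by simp)
    have h2 := wordLength_mul_garside_pow_le (k := p + 3) (by omega) (Nat.zero_le n)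
    simp only [mul_one, wordLength_one, map_one, toAdd_one, pow_zero] at h1 h2
    simp only [← hSdef] at h1 h2
    simp only [hw]
    omega
  have hψ : ∀ n x, horoEmbed S (w n)⁻¹ x = (wordLength S (w n * x) : ℝ) - 2 * n := fun n x => by
    rw [horoEmbed_apply, wordLength_inv hS, hlen, ← wordLength_inv hS]
    simp
  obtain ⟨ξ, hξ⟩ := exists_tendsto_horoEmbed hS (hyperfilter ℕ) fun n => (w n)⁻¹
  have hpt := tendsto_pi_nhds.1 hξ
  have hev : ∀ m : ℕ, ∀ᶠ n in (hyperfilter ℕ : Filter ℕ), m ≤ n := fun m =>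
    Nat.hyperfilter_le_atTop (eventually_ge_atTop m)
  have hξ_garside : ∀ s : ℕ, ξ (garside (p + 3) ^ s) ≤ s * (p + 1) := fun s => by
    refine le_of_tendsto (hpt _) ?_
    filter_upwards [hev s] with n hn
    have h := wordLength_mul_garside_pow_le (k := p + 3) (by omega) hn
    rw [hψ]
    have h' : (wordLength S (w n * garside (p + 3) ^ s) : ℝ) ≤ 2 * n + s * (p + 1) := by
      exact_mod_cast h
    linarith
  have hξ_pow : ∀ m : ℕ, ξ ((a (p + 3) ^ m)⁻¹) ≤ -m := fun m => by
    refine le_of_tendsto (hpt _) ?_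
    filter_upwards [hev m] with n hn
    obtain ⟨j, rfl⟩ := Nat.exists_eq_add_of_le' hn
    have h1 := wordLength_pow_le hS (b (p + 3))⁻¹ (j + m)
    have h2 := wordLength_pow_le hS (a (p + 3)) j
    have h3 := wordLength_mul_le hS ((b (p + 3))⁻¹ ^ (j + m)) (a (p + 3) ^ j)
    rw [wordLength_inv hS] at h1
    have h7 := Nat.mul_le_mul_left (j + m) (wordLength_b_le (k := p + 3))
    have h8 := Nat.mul_le_mul_left j (wordLength_a_le (k := p + 3))
    have e : w (j + m) * (a (p + 3) ^ m)⁻¹ = (b (p + 3))⁻¹ ^ (j + m) * a (p + 3) ^ j := by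
      simp only [hw]
      rw [pow_add (a (p + 3)), ← mul_assoc, mul_inv_cancel_right]
    have h9 : wordLength S (w (j + m) * (a (p + 3) ^ m)⁻¹) + m ≤ 2 * (j + m) := by
      rw [e]
      simp only [← hSdef] at h7 h8
      omega
    have h9' : (wordLength S (w (j + m) * (a (p + 3) ^ m)⁻¹) : ℝ) + m ≤ 2 * ((j + m : ℕ) : ℝ) := by
      exact_mod_cast h9
    rw [hψ]
    linarith
  -- The potential estimate in the limit; it applies as soon as `n` exceeds the length of `y`.
  have hξ_lower : ∀ y, ((deg (p + 3) y).toAdd : ℝ) - wordLength S y ≤ 2 * ξ y := fun y => by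
    refine ge_of_tendsto ((hpt y).const_mul 2) ?_
    filter_upwards [hev (wordLength S y)] with n hn
    have h := le_wordLength_artinGenerators (p := p) hn
    have h' : (4 * n : ℝ) ≤ wordLength S y - ((deg (p + 3) y).toAdd : ℝ) +
        2 * wordLength S (w n * y) := by exact_mod_cast h
    rw [hψ]
    linarith
  refine ⟨ξ, ⟨mem_closure_of_tendsto hξ (Eventually.of_forall fun n => ⟨_, rfl⟩), ?_⟩, ?_⟩
  -- The limit is unbounded below by `hξ_pow`, whereas `horoEmbed S z` is at least minus the length
  -- of `z`.
  · rintro ⟨z, rfl⟩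
    have h1 := hξ_pow (wordLength S z + 1)
    rw [horoEmbed_apply] at h1
    push_cast at h1
    have h2 : (0 : ℝ) ≤ wordLength S ((a (p + 3) ^ (wordLength S z + 1))⁻¹⁻¹ * z) :=
      Nat.cast_nonneg _
    linarith
  · rintro ⟨-, γ, hγ, hlim⟩
    set c := wordLength S (γ 0) with hc
    -- By `hξ_lower` and the slope of ξ along γ, the left side is at most 2|γ m| + 2ξ(γ 0) - 2m, and
    -- |γ m| ≤ c + m.
    have hexcess : ∀ m, (wordLength S (γ m) : ℝ) + (deg (p + 3) (γ m)).toAdd ≤ 4 * c := fun m => by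
      have h1 := hγ.limit_apply hlim m
      have h2 := hξ_lower (γ m)
      have h3 : wordLength S (γ m) ≤ c + m := by
        have h := wordLength_mul_le hS (γ 0) ((γ 0)⁻¹ * γ m)
        have h' := hγ 0 m
        rw [Nat.zero_add, wordDist] at h'
        rwa [mul_inv_cancel_left, h'] at h
      have h3' : (wordLength S (γ m) : ℝ) ≤ c + m := by exact_mod_cast h3
      have h4 : ξ (γ 0) ≤ c := by
        refine le_of_tendsto (hpt _) (Eventually.of_forall fun n => ?_)
        exact (abs_le.1 (abs_horoEmbed_le hS _ _)).2
      linarith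
    -- For `s = 2 * c + 1` the two bounds conflict: s(k - 2) < sk - 4c because 2s > 4c.
    have hs := hξ_garside (2 * c + 1)
    have hge : ((2 * c + 1 : ℕ) : ℝ) * (p + 3) - 4 * c ≤ ξ (garside (p + 3) ^ (2 * c + 1)) := by
      refine ge_of_tendsto (tendsto_pi_nhds.1 hlim _) (Eventually.of_forall fun m => ?_)
      have h1 := natAbs_le_wordLength hS (deg (p + 3)) (by rintro _ (rfl | rfl) <;> simp)
        ((garside (p + 3) ^ (2 * c + 1))⁻¹ * γ m)
      rw [map_mul, map_inv, map_pow, deg_garside, toAdd_mul, toAdd_inv, toAdd_pow, toAdd_ofAdd]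
        at h1
      have h2 : ((2 * c + 1 : ℕ) : ℤ) * (p + 3) - (deg (p + 3) (γ m)).toAdd ≤
          wordLength S ((garside (p + 3) ^ (2 * c + 1))⁻¹ * γ m) := by
        simp only [nsmul_eq_mul] at h1
        push_cast at *
        omega
      have h2' : ((2 * c + 1 : ℕ) : ℝ) * (p + 3) - ((deg (p + 3) (γ m)).toAdd : ℝ) ≤
          wordLength S ((garside (p + 3) ^ (2 * c + 1))⁻¹ * γ m) := by exact_mod_cast h2
      rw [horoEmbed_apply]
      have := hexcess m
      linarith
    push_cast at hs hge
    linarith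

end DihedralArtin

theorem mainTheorem3 (k : ℕ) (hk : 3 ≤ k) :
    (∀ ξ ∈ horoBoundary (DihedralArtin.dualGenerators k),
      IsBusemannPoint (DihedralArtin.dualGenerators k) ξ) ∧
    (∃ ξ ∈ horoBoundary (DihedralArtin.artinGenerators k),
      ¬ IsBusemannPoint (DihedralArtin.artinGenerators k) ξ) := by
  have : NeZero k := ⟨by omega⟩
  refine ⟨fun ξ hξ => DihedralArtin.isBusemannPoint_dualGenerators (by omega) hξ, ?_⟩
  obtain ⟨p, rfl⟩ := Nat.exists_eq_add_of_le' hk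
  exact DihedralArtin.exists_not_isBusemannPoint p
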